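/- Let $\mathcal H$ be a complex Hilbert space, $\mathcal F_-(\mathcal H)$ the Fermionic (antisymmetric) Fock space over it with vacuum $\Omega$, and let $\Phi[f]=a(f)^*+a(f)$, $f\in\mathcal H$, be the bounded Fermi field operators (sum of the CAR creation and annihilation operators). Let $H\subset\mathcal H$ be a closed real linear subspace, $E_H$ the real orthogonal projection onto $H$ with respect to $\operatorname{Re}\langle\cdot,\cdot\rangle$, and $\mathcal M_-(H)=\{\Phi[h]:h\in H\}''$ the von Neumann algebra generated by the fields. Let $X_1$ be a (possibly unbounded) self-adjoint operator on $\mathcal H$ and $X=\overline{\bigoplus_n X_1^{\otimes n}}$ its second quantization on $\mathcal F_-(\mathcal H)$ (so $X\Omega=\Omega$); assume $H\subset\operatorname{dom}(X_1)$ and $\mathcal M_-(H)\Omega\subset\operatorname{dom}(X)$. Define $$\Xi^-_{H,X_1}:\mathcal M_-(H)\to\mathcal F_-(\mathcal H),\qquad A\mapsto XA\Omega .$$ For a bounded linear map $T$ between real or complex normed spaces let $\alpha_n(T)=\inf\{\|T-S\| : S \text{ bounded linear},\ \operatorname{rank}S\le n\}$. For $p>0$, $T$ is $\ell^p$ if $\sum_{n\ge0}\alpha_n(T)^p<\infty$;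 for real linear maps, with real linear $S$ and real rank, this is called $\ell^p_{\mathbb R}$. A linear map $T$ is $p$-nuclear ($0<p\le1$) if $T(b)=\sum_n\varphi_n(b)\,b_n$ for all $b$, with bounded linear functionals $\varphi_n$ and vectors $b_n$ such that $\sum_n\|\varphi_n\|^p\|b_n\|^p<\infty$. Then: (a) If $X_1E_H$ is $\ell^p_{\mathbb R}$ for some $0<p\le 1$, then $\Xi^-_{H,X_1}$ is $p$-nuclear, and it is $\ell^q$ for every $q>p/(1-p)$ if $p<1$, and compact if $p=1$. (No bound on $\|X_1E_H\|$ is assumed.) (b) If $\Xi^-_{H,X_1}$ is $\ell^p$ for some $p>0$, then $X_1E_H$ is $\ell^p_{\mathbb R}$ for the same $p$. (c) $\Xi^-_{H,X_1}$ is $\ell^p$ for all $p>0$ if and only if $X_1E_H$ is $\ell^p_{\mathbb R}$ for all $p>0$. -/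

import Mathlib

/-! ### The inner product on the exterior algebra

For a complex inner product space `𝓗`, the (algebraic) exterior algebra of `𝓗` carries the inner
product with `⟪1, 1⟫ = 1` for which left multiplication by `f` (creation) is adjoint to contraction
with `⟪f, ·⟫` (annihilation); equivalently
`⟪f₁ ∧ ⋯ ∧ fₙ, g₁ ∧ ⋯ ∧ gₘ⟫ = δₙₘ det ⟪fᵢ, gⱼ⟫`. -/

namespace FermiFock

open scoped ComplexInnerProductSpace

variable {𝓗 : Type*} [NormedAddCommGroup 𝓗] [InnerProductSpace ℂ 𝓗]

/-- Contraction of an element of the exterior algebra with the functional `⟪f, ·⟫`. -/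
noncomputable def contract (f : 𝓗) : ExteriorAlgebra ℂ 𝓗 →ₗ[ℂ] ExteriorAlgebra ℂ 𝓗 :=
  CliffordAlgebra.contractLeft (Q := (0 : QuadraticForm ℂ 𝓗)) (innerSL ℂ f).toLinearMap

theorem contract_ι_mul (f g : 𝓗) (x : ExteriorAlgebra ℂ 𝓗) :
    contract f (ExteriorAlgebra.ι ℂ g * x)
      = ⟪f, g⟫ • x - ExteriorAlgebra.ι ℂ g * contract f x :=
  CliffordAlgebra.contractLeft_ι_mul _ _ _

theorem contract_algebraMap (f : 𝓗) (c : ℂ) :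
    contract f (algebraMap ℂ (ExteriorAlgebra ℂ 𝓗) c) = 0 :=
  CliffordAlgebra.contractLeft_algebraMap _ _ _

theorem contract_contract (f : 𝓗) (x : ExteriorAlgebra ℂ 𝓗) : contract f (contract f x) = 0 :=
  CliffordAlgebra.contractLeft_contractLeft _ _

theorem contract_add (f g : 𝓗) (x : ExteriorAlgebra ℂ 𝓗) :
    contract (f + g) x = contract f x + contract g x := by
  simp only [contract]
  rw [← LinearMap.add_apply, ← map_add]
  congr 2
  ext y; simp

theorem contract_smul (c : ℂ) (f : 𝓗) (x : ExteriorAlgebra ℂ 𝓗) :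
    contract (c • f) x = (starRingEnd ℂ) c • contract f x := by
  simp only [contract]
  rw [← LinearMap.smul_apply, ← map_smul]
  congr 2
  ext y; simp

/-- `f` acts on antilinear functionals of the exterior algebra by precomposition with the
contraction by `f`. -/
noncomputable def functionalAction :
    𝓗 →ₗ[ℂ] Module.End ℂ (ExteriorAlgebra ℂ 𝓗 →ₗ⋆[ℂ] ℂ) where
  toFun f :=
    { toFun := fun β => β.comp (contract f)
      map_add' := fun _ _ => rfl
      map_smul' := fun _ _ => rfl }
  map_add' f g := by
    ext β x
    simp [contract_add]
  map_smul' c f := by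
    ext β x
    simp [contract_smul]

/-- The antilinear functional `y ↦ conj (vacuum component of y)`. -/
noncomputable def vacuumFunctional : ExteriorAlgebra ℂ 𝓗 →ₗ⋆[ℂ] ℂ where
  toFun y := (starRingEnd ℂ) (ExteriorAlgebra.algebraMapInv y)
  map_add' _ _ := by simp
  map_smul' _ _ := by simp

/-- The sesquilinear form: `form x y = ⟪y, x⟫`, linear in `x` and antilinear in `y`. -/
noncomputable def form : ExteriorAlgebra ℂ 𝓗 →ₗ[ℂ] ExteriorAlgebra ℂ 𝓗 →ₗ⋆[ℂ] ℂ :=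
  (LinearMap.applyₗ vacuumFunctional).comp
    (ExteriorAlgebra.lift ℂ ⟨functionalAction, fun f => by
      ext β x
      simp [functionalAction, contract_contract]⟩).toLinearMap

theorem form_ι_mul (f : 𝓗) (x y : ExteriorAlgebra ℂ 𝓗) :
    form (ExteriorAlgebra.ι ℂ f * x) y = form x (contract f y) := by
  simp [form, functionalAction]

theorem form_algebraMap (c : ℂ) (y : ExteriorAlgebra ℂ 𝓗) :
    form (algebraMap ℂ _ c) y = c * (starRingEnd ℂ) (ExteriorAlgebra.algebraMapInv y) := by
  simp [form, vacuumFunctional, Algebra.algebraMap_eq_smul_one]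

theorem algebraMapInv_ι_mul (f : 𝓗) (x : ExteriorAlgebra ℂ 𝓗) :
    ExteriorAlgebra.algebraMapInv (ExteriorAlgebra.ι ℂ f * x) = 0 := by
  simp [ExteriorAlgebra.algebraMapInv]

theorem form_right_ι_mul (f : 𝓗) (x y : ExteriorAlgebra ℂ 𝓗) :
    form x (ExteriorAlgebra.ι ℂ f * y) = form (contract f x) y := by
  induction x using CliffordAlgebra.left_induction generalizing y with
  | algebraMap r =>
    erw [form_algebraMap, contract_algebraMap, algebraMapInv_ι_mul]; simp
  | add x₁ x₂ h₁ h₂ => simp only [map_add, LinearMap.add_apply, h₁, h₂]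
  | ι_mul x m ih =>
    erw [form_ι_mul, contract_ι_mul, contract_ι_mul, map_sub, map_sub, ih]
    erw [LinearMap.sub_apply, form_ι_mul]
    simp

theorem form_conj (x y : ExteriorAlgebra ℂ 𝓗) :
    (starRingEnd ℂ) (form x y) = form y x := by
  induction x using CliffordAlgebra.left_induction generalizing y with
  | algebraMap r =>
    erw [form_algebraMap]
    induction y using CliffordAlgebra.left_induction with
    | algebraMap s =>
      erw [form_algebraMap]
      erw [ExteriorAlgebra.algebraMap_leftInverse, ExteriorAlgebra.algebraMap_leftInverse]
      simp [mul_comm]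
    | add y₁ y₂ h₁ h₂ =>
      simp only [map_add, LinearMap.add_apply, ← h₁, ← h₂, map_mul]
      ring
    | ι_mul y m _ =>
      erw [algebraMapInv_ι_mul, form_ι_mul, contract_algebraMap]; simp
  | add x₁ x₂ h₁ h₂ => simp only [map_add, LinearMap.add_apply, h₁, h₂]
  | ι_mul x m ih =>
    erw [form_ι_mul, form_right_ι_mul, ih]

/-- The subspace of the exterior algebra generated by a subspace `W`. -/
noncomputable def sub (W : Submodule ℂ 𝓗) : Submodule ℂ (ExteriorAlgebra ℂ 𝓗) :=
  LinearMap.range (ExteriorAlgebra.map W.subtype).toLinearMap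

theorem algebraMap_mem_sub (W : Submodule ℂ 𝓗) (c : ℂ) :
    algebraMap ℂ (ExteriorAlgebra ℂ 𝓗) c ∈ sub W :=
  ⟨algebraMap ℂ _ c, by simp⟩

theorem ι_mul_mem_sub {W : Submodule ℂ 𝓗} {w : 𝓗} (hw : w ∈ W) {x : ExteriorAlgebra ℂ 𝓗}
    (hx : x ∈ sub W) : ExteriorAlgebra.ι ℂ w * x ∈ sub W := by
  obtain ⟨x, rfl⟩ := hx
  exact ⟨ExteriorAlgebra.ι ℂ ⟨w, hw⟩ * x, by simp⟩

theorem sub_induction {W : Submodule ℂ 𝓗} {P : ExteriorAlgebra ℂ 𝓗 → Prop}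
    (h₀ : ∀ c, P (algebraMap ℂ _ c)) (hadd : ∀ x y, P x → P y → P (x + y))
    (hmul : ∀ w ∈ W, ∀ x, P x → P (ExteriorAlgebra.ι ℂ w * x))
    {x : ExteriorAlgebra ℂ 𝓗} (hx : x ∈ sub W) : P x := by
  obtain ⟨x, rfl⟩ := hx
  induction x using CliffordAlgebra.left_induction with
  | algebraMap r =>
    have : (ExteriorAlgebra.map W.subtype).toLinearMap (algebraMap ℂ (ExteriorAlgebra ℂ W) r)
      = algebraMap ℂ _ r := by simp
    exact this ▸ h₀ r
  | add x₁ x₂ h₁ h₂ => rw [map_add]; exact hadd _ _ h₁ h₂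
  | ι_mul x m ih =>
    have : (ExteriorAlgebra.map W.subtype).toLinearMap (ExteriorAlgebra.ι ℂ m * x)
      = ExteriorAlgebra.ι ℂ (m : 𝓗) * (ExteriorAlgebra.map W.subtype).toLinearMap x := by simp
    exact this ▸ hmul m m.2 _ ih

theorem sub_mono {V W : Submodule ℂ 𝓗} (h : V ≤ W) : sub V ≤ sub W := fun _ hx =>
  sub_induction (P := fun x => x ∈ sub W) (algebraMap_mem_sub W) (fun _ _ => Submodule.add_mem _)
    (fun _ hw _ hx => ι_mul_mem_sub (h hw) hx) hx

theorem exists_mem_sub (x : ExteriorAlgebra ℂ 𝓗) :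
    ∃ W : Submodule ℂ 𝓗, FiniteDimensional ℂ W ∧ x ∈ sub W := by
  induction x using CliffordAlgebra.left_induction with
  | algebraMap r => exact ⟨⊥, inferInstance, algebraMap_mem_sub _ r⟩
  | add x y hx hy =>
    obtain ⟨V, _, hx⟩ := hx
    obtain ⟨W, _, hy⟩ := hy
    exact ⟨V ⊔ W, inferInstance,
      Submodule.add_mem _ (sub_mono le_sup_left hx) (sub_mono le_sup_right hy)⟩
  | ι_mul x m hx =>
    obtain ⟨V, _, hx⟩ := hx
    exact ⟨Submodule.span ℂ {m} ⊔ V, inferInstance,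
      ι_mul_mem_sub (Submodule.mem_sup_left (Submodule.mem_span_singleton_self m))
        (sub_mono le_sup_right hx)⟩

theorem contract_eq_zero {W : Submodule ℂ 𝓗} {e : 𝓗} (he : ∀ w ∈ W, ⟪e, w⟫ = 0)
    {x : ExteriorAlgebra ℂ 𝓗} (hx : x ∈ sub W) : contract e x = 0 := by
  refine sub_induction (P := fun x => contract e x = 0) (contract_algebraMap e)
    (fun x y hx hy => by rw [map_add, hx, hy, add_zero]) (fun w hw x hx => ?_) hx
  rw [contract_ι_mul, he w hw, hx]; simp

theorem exists_decomposition {W W' : Submodule ℂ 𝓗} {e : 𝓗}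
    (h : ∀ w ∈ W, ∃ c : ℂ, ∃ w' ∈ W', w = c • e + w') {x : ExteriorAlgebra ℂ 𝓗} (hx : x ∈ sub W) :
    ∃ a ∈ sub W', ∃ b ∈ sub W', x = a + ExteriorAlgebra.ι ℂ e * b := by
  refine sub_induction (P := fun x => ∃ a ∈ sub W', ∃ b ∈ sub W', x = a + ExteriorAlgebra.ι ℂ e * b)
    (fun c => ⟨_, algebraMap_mem_sub W' c, 0, Submodule.zero_mem _, by simp⟩) ?_ ?_ hx
  · rintro _ _ ⟨a, ha, b, hb, rfl⟩ ⟨a', ha', b', hb', rfl⟩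
    exact ⟨a + a', Submodule.add_mem _ ha ha', b + b', Submodule.add_mem _ hb hb', by
      rw [mul_add]; abel⟩
  · rintro w hw _ ⟨a, ha, b, hb, rfl⟩
    obtain ⟨c, w', hw', rfl⟩ := h w hw
    refine ⟨_, ι_mul_mem_sub hw' ha, c • a - ExteriorAlgebra.ι ℂ w' * b,
      Submodule.sub_mem _ (Submodule.smul_mem _ _ ha) (ι_mul_mem_sub hw' hb), ?_⟩
    have h1 : ExteriorAlgebra.ι ℂ e * ExteriorAlgebra.ι ℂ e = 0 := ExteriorAlgebra.ι_sq_zero e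
    have h2 : ExteriorAlgebra.ι ℂ w' * ExteriorAlgebra.ι ℂ e
        = -(ExteriorAlgebra.ι ℂ e * ExteriorAlgebra.ι ℂ w') :=
      eq_neg_of_add_eq_zero_left (ExteriorAlgebra.ι_add_mul_swap w' e)
    rw [map_add, map_smul, add_mul, mul_add, mul_add, mul_sub, smul_mul_assoc, smul_mul_assoc,
      mul_smul_comm, ← mul_assoc, ← mul_assoc, ← mul_assoc, h1, h2, neg_mul]
    simp only [zero_mul, smul_zero]
    abel

theorem form_decomposition {W : Submodule ℂ 𝓗} {e : 𝓗} (he : ∀ w ∈ W, ⟪e, w⟫ = 0)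
    (he1 : ‖e‖ = 1) {a b : ExteriorAlgebra ℂ 𝓗} (ha : a ∈ sub W) (hb : b ∈ sub W) :
    form (a + ExteriorAlgebra.ι ℂ e * b) (a + ExteriorAlgebra.ι ℂ e * b)
      = form a a + form b b := by
  have h1 : ⟪e, e⟫ = 1 := by rw [inner_self_eq_norm_sq_to_K, he1]; simp
  simp only [map_add, LinearMap.add_apply, form_ι_mul, form_right_ι_mul, contract_ι_mul,
    contract_eq_zero he ha, contract_eq_zero he hb, h1]
  simp

theorem form_sub (n : ℕ) (W : Submodule ℂ 𝓗) [FiniteDimensional ℂ W]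
    (hn : Module.finrank ℂ W ≤ n) {x : ExteriorAlgebra ℂ 𝓗} (hx : x ∈ sub W) :
    0 ≤ (form x x).re ∧ (form x x = 0 → x = 0) := by
  induction n generalizing W x with
  | zero =>
    have hW : W = ⊥ := Submodule.finrank_eq_zero.mp (Nat.le_zero.mp hn)
    have : ∃ c : ℂ, x = algebraMap ℂ _ c := by
      refine sub_induction (P := fun x => ∃ c : ℂ, x = algebraMap ℂ _ c)
        (fun c => ⟨c, rfl⟩) ?_ ?_ hx
      · rintro _ _ ⟨c, rfl⟩ ⟨d, rfl⟩
        exact ⟨c + d, by simp⟩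
      · rintro w hw _ _
        rw [hW, Submodule.mem_bot] at hw
        exact ⟨0, by simp [hw]⟩
    obtain ⟨c, rfl⟩ := this
    rw [form_algebraMap, ExteriorAlgebra.algebraMap_leftInverse, Complex.mul_conj]
    refine ⟨by simpa using Complex.normSq_nonneg c, fun h => ?_⟩
    have : c = 0 := by simpa using h
    simp [this]
  | succ n ih =>
    by_cases hW : W = ⊥
    · subst hW
      exact ih ⊥ (by simp) hx
    obtain ⟨w₀, hw₀, hw₀'⟩ := Submodule.exists_mem_ne_zero_of_ne_bot hW
    set e : 𝓗 := ((‖w₀‖ : ℂ)⁻¹) • w₀ with he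
    have he1 : ‖e‖ = 1 := norm_smul_inv_norm hw₀'
    have heW : e ∈ W := Submodule.smul_mem _ _ hw₀
    have hee : ⟪e, e⟫ = 1 := by rw [inner_self_eq_norm_sq_to_K, he1]; simp
    set W' : Submodule ℂ 𝓗 := W ⊓ (Submodule.span ℂ {e})ᗮ with hW'
    have heW' : ∀ w ∈ W', ⟪e, w⟫ = 0 := fun w hw =>
      Submodule.mem_orthogonal_singleton_iff_inner_right.mp hw.2
    have hlt : W' < W := by
      refine lt_of_le_of_ne inf_le_left fun h => ?_
      have := heW' e (h ▸ heW)
      rw [hee] at this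
      exact one_ne_zero this
    have : FiniteDimensional ℂ W' := Submodule.finiteDimensional_of_le hlt.le
    have hrank : Module.finrank ℂ W' ≤ n := by
      have := Submodule.finrank_lt_finrank_of_lt hlt
      omega
    obtain ⟨a, ha, b, hb, rfl⟩ := exists_decomposition (W' := W') (e := e) (fun w hw =>
      ⟨⟪e, w⟫, w - ⟪e, w⟫ • e, ⟨Submodule.sub_mem _ hw (Submodule.smul_mem _ _ heW), by
        rw [SetLike.mem_coe, Submodule.mem_orthogonal_singleton_iff_inner_right, inner_sub_right,
          inner_smul_right, hee]
        simp⟩, by abel⟩) hx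
    obtain ⟨ha0, ha1⟩ := ih W' hrank ha
    obtain ⟨hb0, hb1⟩ := ih W' hrank hb
    rw [form_decomposition heW' he1 ha hb]
    refine ⟨by rw [Complex.add_re]; exact add_nonneg ha0 hb0, fun h => ?_⟩
    have hre : (form a a).re + (form b b).re = 0 := by rw [← Complex.add_re, h]; rfl
    have him : ∀ z : ExteriorAlgebra ℂ 𝓗, (form z z).im = 0 := fun z =>
      Complex.conj_eq_iff_im.mp (form_conj z z)
    rw [ha1 (Complex.ext (by simp; linarith) (him a)), hb1 (Complex.ext (by simp; linarith) (him b))]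
    simp

/-- The inner product on the exterior algebra of a complex inner product space. -/
@[reducible] noncomputable def core (𝓗 : Type*) [NormedAddCommGroup 𝓗] [InnerProductSpace ℂ 𝓗] :
    InnerProductSpace.Core ℂ (ExteriorAlgebra ℂ 𝓗) where
  inner x y := form y x
  conj_inner_symm x y := form_conj x y
  re_inner_nonneg x := by
    obtain ⟨W, _, hW⟩ := exists_mem_sub x
    exact (form_sub _ W le_rfl hW).1
  add_left x y z := by simp
  smul_left x y r := by simp
  definite x h := by
    obtain ⟨W, _, hW⟩ := exists_mem_sub x
    exact (form_sub _ W le_rfl hW).2 h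

noncomputable instance : NormedAddCommGroup (ExteriorAlgebra ℂ 𝓗) :=
  (core 𝓗).toNormedAddCommGroup

noncomputable instance : InnerProductSpace ℂ (ExteriorAlgebra ℂ 𝓗) :=
  InnerProductSpace.ofCore (core 𝓗).toCore

theorem inner_one_one : ⟪(1 : ExteriorAlgebra ℂ 𝓗), 1⟫ = 1 := by
  change form (1 : ExteriorAlgebra ℂ 𝓗) 1 = 1
  have := form_algebraMap (𝓗 := 𝓗) 1 1
  simpa using this

theorem inner_ι_mul (f : 𝓗) (x y : ExteriorAlgebra ℂ 𝓗) :
    ⟪ExteriorAlgebra.ι ℂ f * x, y⟫ = ⟪x, contract f y⟫ :=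
  form_right_ι_mul f y x

theorem norm_ι_mul_le (f : 𝓗) (x : ExteriorAlgebra ℂ 𝓗) :
    ‖ExteriorAlgebra.ι ℂ f * x‖ ≤ ‖f‖ * ‖x‖ := by
  have h : ⟪ExteriorAlgebra.ι ℂ f * x, ExteriorAlgebra.ι ℂ f * x⟫
      = ⟪f, f⟫ * ⟪x, x⟫ - ⟪contract f x, contract f x⟫ := by
    rw [inner_ι_mul, contract_ι_mul, inner_sub_right, inner_smul_right,
      ← inner_conj_symm x (ExteriorAlgebra.ι ℂ f * contract f x), inner_ι_mul, inner_conj_symm]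
  simp only [inner_self_eq_norm_sq_to_K] at h
  have h' : ‖ExteriorAlgebra.ι ℂ f * x‖ ^ 2 = ‖f‖ ^ 2 * ‖x‖ ^ 2 - ‖contract f x‖ ^ 2 := by
    exact_mod_cast h
  refine le_of_sq_le_sq ?_ (by positivity)
  rw [mul_pow, h']
  nlinarith [sq_nonneg ‖contract f x‖]

end FermiFock

/-! ### Fermi Fock space, field operators and the field algebra -/

/-- The Fermionic (antisymmetric) Fock space over `𝓗`: the Hilbert space completion of the exterior
algebra, i.e. the Hilbert space direct sum of the completed antisymmetric tensor powers of `𝓗`. -/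
abbrev FermiFockSpace (𝓗 : Type*) [NormedAddCommGroup 𝓗] [InnerProductSpace ℂ 𝓗] : Type _ :=
  UniformSpace.Completion (ExteriorAlgebra ℂ 𝓗)

namespace FermiFock

variable {𝓗 : Type*} [NormedAddCommGroup 𝓗] [InnerProductSpace ℂ 𝓗]

/-- The Fock vacuum. -/
noncomputable def vacuum (𝓗 : Type*) [NormedAddCommGroup 𝓗] [InnerProductSpace ℂ 𝓗] :
    FermiFockSpace 𝓗 :=
  ((1 : ExteriorAlgebra ℂ 𝓗) : UniformSpace.Completion (ExteriorAlgebra ℂ 𝓗))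

/-- The creation operator `a(f)*`: the bounded extension of `x ↦ f ∧ x`. -/
noncomputable def creation (f : 𝓗) : FermiFockSpace 𝓗 →L[ℂ] FermiFockSpace 𝓗 :=
  ((LinearMap.mulLeft ℂ (ExteriorAlgebra.ι ℂ f)).mkContinuous ‖f‖ (norm_ι_mul_le f)).completion

/-- The annihilation operator `a(f)`. -/
noncomputable def annihilation (f : 𝓗) : FermiFockSpace 𝓗 →L[ℂ] FermiFockSpace 𝓗 :=
  ContinuousLinearMap.adjoint (creation f)

/-- The Fermi field operator `Φ[f] = a(f)* + a(f)`. -/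
noncomputable def field (f : 𝓗) : FermiFockSpace 𝓗 →L[ℂ] FermiFockSpace 𝓗 :=
  creation f + annihilation f

/-- The commutant of the field operators `Φ[h]`, `h ∈ H` (which are self-adjoint). -/
noncomputable def fieldCommutant (H : ClosedSubmodule ℝ 𝓗) :
    VonNeumannAlgebra (FermiFockSpace 𝓗) where
  toStarSubalgebra := StarSubalgebra.centralizer ℂ (field '' (H : Set 𝓗))
  centralizer_centralizer' := by
    simp only [Subsemiring.coe_carrier_toSubmonoid, Subalgebra.coe_toSubsemiring,
      StarSubalgebra.coe_toSubalgebra, StarSubalgebra.coe_centralizer]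
    exact Set.centralizer_centralizer_centralizer _

/-- The von Neumann algebra `M₋(H)` generated by the field operators `Φ[h]`, `h ∈ H`, that is,
their double commutant. -/
noncomputable def fieldAlgebra (H : ClosedSubmodule ℝ 𝓗) : VonNeumannAlgebra (FermiFockSpace 𝓗) :=
  (fieldCommutant H).commutant

theorem coe_fieldAlgebra (H : ClosedSubmodule ℝ 𝓗) :
    (fieldAlgebra H : Set (FermiFockSpace 𝓗 →L[ℂ] FermiFockSpace 𝓗))
      = Set.centralizer (Set.centralizer (field '' (H : Set 𝓗))) := by
  have hstar : star (field '' (H : Set 𝓗)) = field '' (H : Set 𝓗) := by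
    have h : ∀ f : 𝓗, star (field f) = field f := fun f => by
      rw [field, annihilation, ← ContinuousLinearMap.star_eq_adjoint, star_add, star_star, add_comm]
    ext A
    constructor
    · rintro ⟨f, hf, hA⟩
      exact ⟨f, hf, by rw [← star_star A, ← hA, h]⟩
    · rintro ⟨f, hf, rfl⟩
      exact ⟨f, hf, (h f).symm⟩
  rw [fieldAlgebra, VonNeumannAlgebra.coe_commutant, fieldCommutant, VonNeumannAlgebra.coe_mk,
    StarSubalgebra.coe_centralizer, hstar, Set.union_self]

/-! ### Second quantization of a one-particle operator -/

/-- The linear map `ExteriorAlgebra D → F₋(𝓗)` with `d₁ ∧ ⋯ ∧ dₙ ↦ T d₁ ∧ ⋯ ∧ T dₙ` induced by a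
linear map `T : D → 𝓗` on a subspace `D`. -/
noncomputable def exteriorMap {D : Submodule ℂ 𝓗} (T : D →ₗ[ℂ] 𝓗) :
    ExteriorAlgebra ℂ D →ₗ[ℂ] FermiFockSpace 𝓗 :=
  (UniformSpace.Completion.toComplₗᵢ (𝕜 := ℂ) (E := ExteriorAlgebra ℂ 𝓗)).toLinearMap ∘ₗ
    (ExteriorAlgebra.map T).toLinearMap

theorem exteriorMap_subtype_injective (D : Submodule ℂ 𝓗) :
    Function.Injective (exteriorMap D.subtype) :=
  (UniformSpace.Completion.toComplₗᵢ (𝕜 := ℂ) (E := ExteriorAlgebra ℂ 𝓗)).injective.comp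
    (ExteriorAlgebra.map_injective_field D.ker_subtype)

/-- `⨁ₙ X₁^{⊗ n}` on the algebraic domain: the span of the vacuum and of the vectors
`f₁ ∧ ⋯ ∧ fₙ` with all `fᵢ` in the domain of `X₁`, on which it acts by
`Ω ↦ Ω` and `f₁ ∧ ⋯ ∧ fₙ ↦ X₁ f₁ ∧ ⋯ ∧ X₁ fₙ`. -/
noncomputable def secondQuantizationCore (X₁ : 𝓗 →ₗ.[ℂ] 𝓗) :
    FermiFockSpace 𝓗 →ₗ.[ℂ] FermiFockSpace 𝓗 where
  domain := LinearMap.range (exteriorMap X₁.domain.subtype)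
  toFun := exteriorMap X₁.toFun ∘ₗ
    (LinearEquiv.ofInjective _ (exteriorMap_subtype_injective X₁.domain)).symm.toLinearMap

/-- The second quantization `X` of `X₁` on the Fermi Fock space: the closure of the algebraic
second quantization. For self-adjoint `X₁` this is the self-adjoint operator `⨁ₙ X₁^{⊗ n}`. -/
noncomputable def secondQuantization (X₁ : 𝓗 →ₗ.[ℂ] 𝓗) :
    FermiFockSpace 𝓗 →ₗ.[ℂ] FermiFockSpace 𝓗 :=
  (secondQuantizationCore X₁).closure

/-- The map `Ξ⁻ : M₋(H) → F₋(𝓗)`, `A ↦ X A Ω`, where `X` is the second quantization of `X₁`. -/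
noncomputable def xi (H : ClosedSubmodule ℝ 𝓗) (X₁ : 𝓗 →ₗ.[ℂ] 𝓗)
    (hX : ∀ A ∈ fieldAlgebra H, A (vacuum 𝓗) ∈ (secondQuantization X₁).domain) :
    (fieldAlgebra H).toStarSubalgebra →ₗ[ℂ] FermiFockSpace 𝓗 where
  toFun A := secondQuantization X₁ ⟨A.1 (vacuum 𝓗), hX A.1 A.2⟩
  map_add' A B := by
    rw [← LinearPMap.map_add]
    rfl
  map_smul' c A := by
    rw [RingHom.id_apply, ← LinearPMap.map_smul]
    rfl

/-! ### The one-particle operator -/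

open scoped ClosedSubmodule in
/-- The real orthogonal projection `E_H` onto the closed real subspace `H`, with respect to the
real scalar product `re ⟪·, ·⟫`. -/
noncomputable def realProjection [CompleteSpace 𝓗] (H : ClosedSubmodule ℝ 𝓗) : 𝓗 →L[ℝ] 𝓗 :=
  H.toSubmodule.starProjection

open scoped ClosedSubmodule in
theorem realProjection_mem [CompleteSpace 𝓗] (H : ClosedSubmodule ℝ 𝓗) (x : 𝓗) :
    realProjection H x ∈ H :=
  Submodule.starProjection_apply_mem H.toSubmodule x

/-- The real linear operator `X₁ E_H` on `𝓗`, for `H` contained in the domain of `X₁`. -/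
noncomputable def oneParticleOperator [CompleteSpace 𝓗] (H : ClosedSubmodule ℝ 𝓗)
    (X₁ : 𝓗 →ₗ.[ℂ] 𝓗) (hH : ∀ h ∈ H, h ∈ X₁.domain) : 𝓗 →ₗ[ℝ] 𝓗 where
  toFun x := X₁ ⟨realProjection H x, hH _ (realProjection_mem H x)⟩
  map_add' x y := by
    rw [← LinearPMap.map_add]
    congr 1
    exact Subtype.ext (map_add (realProjection H) x y)
  map_smul' c x := by
    have h := X₁.map_smul (c : ℂ) ⟨realProjection H x, hH _ (realProjection_mem H x)⟩
    refine Eq.trans ?_ (h.trans (Complex.coe_smul _ _))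
    congr 1
    refine Subtype.ext ?_
    exact ((realProjection H).map_smul c x).trans (Complex.coe_smul c _).symm

end FermiFock

/-! ### `ℓ^p` maps and `p`-nuclear maps -/

namespace BanachIdeal

variable {𝕜 E F : Type*} [RCLike 𝕜] [NormedAddCommGroup E] [NormedSpace 𝕜 E]
  [NormedAddCommGroup F] [NormedSpace 𝕜 F]

/-- The `n`-th approximation number: the infimum of `‖T - S‖` over bounded `S` of rank (over `𝕜`)
at most `n`. -/
noncomputable def approximationNumber (T : E →L[𝕜] F) (n : ℕ) : ℝ :=
  sInf {r : ℝ | ∃ S : E →L[𝕜] F, LinearMap.rank (S : E →ₗ[𝕜] F) ≤ n ∧ r = ‖T - S‖}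

/-- A linear map is `ℓ^p` if it is bounded and its approximation numbers are `p`-summable. For
`𝕜 = ℝ` this is the notion `ℓ^p_ℝ`. -/
def IsEllP (p : ℝ) (T : E →ₗ[𝕜] F) : Prop :=
  ∃ T' : E →L[𝕜] F, (T' : E →ₗ[𝕜] F) = T ∧ Summable fun n => approximationNumber T' n ^ p

/-- A linear map `T` is `p`-nuclear if `T x = ∑ₙ φₙ(x) bₙ` for all `x`, with bounded functionals
`φₙ` and vectors `bₙ` such that `∑ₙ ‖φₙ‖^p ‖bₙ‖^p < ∞`. -/
def IsPNuclear (p : ℝ) (T : E →ₗ[𝕜] F) : Prop :=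
  ∃ (φ : ℕ → StrongDual 𝕜 E) (b : ℕ → F),
    (∀ x, HasSum (fun n => φ n x • b n) (T x)) ∧ Summable fun n => ‖φ n‖ ^ p * ‖b n‖ ^ p

end BanachIdeal

/-! ### Nuclear and `ℓ^p` maps between normed spaces. -/

namespace BanachIdeal

/-! The heart of (a) is an explicit series for `X A Ω` built from a nuclear decomposition of the
one-particle map. Since `𝓗` is a Hilbert space, telescoping near-optimal approximations of rank `2 ^
j` turns the `ℓ^p` hypothesis into `X₁ h = ∑ₖ re ⟪uₖ, h⟫ bₖ` on `H`, where `∑ₖ (‖uₖ‖ ‖bₖ‖) ^ p` is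
finite and `uₖ ∈ H` (`IsEllP.isPNuclear`, `exists_decomposition_oneParticleOperator`).

Let `γ` be conjugation by parity and `∂ᵤ A = (Φ[u] A - γ(A) Φ[u]) / 2`. On vectors `A Ω` with `A` in
the field algebra, annihilation operators act as norm limits of such graded derivations. Put `T₀ A =
⟪Ω, A Ω⟫ Ω` and `Tₙ₊₁ A = (n + 1)⁻¹ ∑ₖ a(bₖ)* Tₙ(∂_{uₖ} A)`. Each step costs a fixed factor divided
by `n + 1`, so the nuclear bounds carry a factor `(x ^ n / n!) ^ p`. These are summable for every
`x`, which is why no bound on the norm of `X₁ E_H` is needed (`pNuclearBound_expansion`).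

It remains to see that `∑ₙ Tₙ A = X A Ω` (`xi_eq_expansion`). Both sides are tested against wedge
products of vectors of the dense domain of `X₁`. Removing a factor `z` replaces `A` by `∂_B A`, with
`B = ∑ₖ ⟪z, bₖ⟫ Φ[uₖ]`, on both sides: for the series by the anticommutation relations
(`annihilation_expansion`), for `X A Ω` because `a(X₁ z) - B / 2` anticommutes with every `Φ[h]`, so
that its product with parity lies in the commutant (`annihilation_apply_vacuum`). Only the vacuum
component is left to compare.

A `p`-nuclear map is approximated by its largest terms, which gives `ℓ^q`, and by its partial sums,
which gives compactness. For (b), `Ξ(Φ[h]) = X₁ h` in the one-particle space, so `X₁ E_H` is `Ξ`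
composed with bounded real linear maps; passing from complex to real rank only doubles indices. Then
(c) follows, since `p / (1 - p)` tends to `0` with `p`. -/

theorem summable_of_summable_rpow {ι : Type*} {c : ι → ℝ} {p : ℝ} (hp : 0 < p) (hp1 : p ≤ 1)
    (hc : ∀ i, 0 ≤ c i) (h : Summable fun i => c i ^ p) : Summable c := by
  refine Summable.of_norm_bounded_eventually h ?_
  filter_upwards [h.tendsto_cofinite_zero.eventually (gt_mem_nhds one_pos)] with i hi
  rw [Real.norm_of_nonneg (hc i)]
  rcases (hc i).eq_or_lt with h0 | h0
  · rw [← h0, Real.zero_rpow hp.ne']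
  · have h1 : c i ≤ 1 := by
      by_contra! h1
      exact absurd (Real.one_le_rpow h1.le hp.le) (not_le.mpr hi)
    simpa using Real.rpow_le_rpow_of_exponent_ge h0 h1 hp1

section

variable {𝕜 E F : Type*} [RCLike 𝕜] [NormedAddCommGroup E] [NormedSpace 𝕜 E]
  [NormedAddCommGroup F] [NormedSpace 𝕜 F]

/-- `T` is `p`-nuclear, with a decomposition whose `p`-th power sum is at most `C`. -/
def PNuclearBound (p C : ℝ) (T : E →ₗ[𝕜] F) : Prop :=
  ∃ (φ : ℕ → StrongDual 𝕜 E) (b : ℕ → F),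
    (∀ x, HasSum (fun n => φ n x • b n) (T x)) ∧
      (Summable fun n => (‖φ n‖ * ‖b n‖) ^ p) ∧ ∑' n, (‖φ n‖ * ‖b n‖) ^ p ≤ C

theorem PNuclearBound.isPNuclear {p C : ℝ} {T : E →ₗ[𝕜] F} (h : PNuclearBound p C T) :
    IsPNuclear p T := by
  obtain ⟨φ, b, h1, h2, -⟩ := h
  refine ⟨φ, b, h1, h2.congr fun n => ?_⟩
  rw [Real.mul_rpow (norm_nonneg _) (norm_nonneg _)]

theorem pNuclearBound_of_fintype {ι : Type*} [Fintype ι] {p C : ℝ} (hp : 0 < p) {T : E →ₗ[𝕜] F}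
    (φ : ι → StrongDual 𝕜 E) (b : ι → F) (hT : ∀ x, T x = ∑ i, φ i x • b i)
    (hC : ∑ i, (‖φ i‖ * ‖b i‖) ^ p ≤ C) : PNuclearBound p C T := by
  classical
  let e : ι → ℕ := fun i => (Fintype.equivFin ι i : ℕ)
  have he : Function.Injective e := Fin.val_injective.comp (Fintype.equivFin ι).injective
  have hs : HasSum (fun n => (‖Function.extend e φ 0 n‖ * ‖Function.extend e b 0 n‖) ^ p)
      (∑ i, (‖φ i‖ * ‖b i‖) ^ p) := by
    rw [← he.hasSum_iff]
    · convert hasSum_fintype (fun i => (‖φ i‖ * ‖b i‖) ^ p) using 2 with i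
      simp [he.extend_apply]
    · intro n hn
      rw [Function.extend_apply' _ _ _ hn]
      simp [Real.zero_rpow hp.ne']
  refine ⟨Function.extend e φ 0, Function.extend e b 0, fun x => ?_, hs.summable, hs.tsum_eq ▸ hC⟩
  rw [← he.hasSum_iff]
  · rw [hT]
    convert hasSum_fintype (fun i => φ i x • b i) using 2 with i
    simp [he.extend_apply]
  · intro n hn
    rw [Function.extend_apply' _ _ _ hn, Function.extend_apply' _ _ _ hn]
    simp

theorem PNuclearBound.mono {p C D : ℝ} {T : E →ₗ[𝕜] F} (h : PNuclearBound p C T) (hCD : C ≤ D) :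
    PNuclearBound p D T := by
  obtain ⟨φ, b, h1, h2, h3⟩ := h
  exact ⟨φ, b, h1, h2, h3.trans hCD⟩

theorem PNuclearBound.nonneg {p C : ℝ} {T : E →ₗ[𝕜] F} (h : PNuclearBound p C T) : 0 ≤ C := by
  obtain ⟨φ, b, h1, h2, h3⟩ := h
  exact (tsum_nonneg fun n => by positivity).trans h3

/-- Decompositions are concatenated over `ℕ × ℕ`, so the sums of `p`-th powers add with no constant.
The condition `p ≤ 1` makes the double series absolutely convergent, hence independent of the order
of summation. -/
theorem pNuclearBound_of_hasSum [CompleteSpace F] {p : ℝ} (hp : 0 < p) (hp1 : p ≤ 1)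
    {T : E →ₗ[𝕜] F} {S : ℕ → E →ₗ[𝕜] F} {C : ℕ → ℝ} (hS : ∀ j, PNuclearBound p (C j) (S j))
    (hC : Summable C) (hT : ∀ x, HasSum (fun j => S j x) (T x)) :
    PNuclearBound p (∑' j, C j) T := by
  choose φ b h1 h2 h3 using hS
  set g : ℕ × ℕ → ℝ := fun i => (‖φ i.1 i.2‖ * ‖b i.1 i.2‖) ^ p with hg
  have hg0 : 0 ≤ g := fun i => by positivity
  have hsum : Summable g := by
    rw [summable_prod_of_nonneg hg0]
    exact ⟨h2, hC.of_nonneg_of_le (fun j => tsum_nonneg fun n => hg0 (j, n)) h3⟩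
  have hle : ∑' i, g i ≤ ∑' j, C j := by
    rw [hsum.tsum_prod]
    exact Summable.tsum_le_tsum h3 hsum.prod hC
  have hsum1 := summable_of_summable_rpow hp hp1 (fun i => by positivity) hsum
  let e : ℕ ≃ ℕ × ℕ := Nat.pairEquiv.symm
  refine ⟨fun n => φ (e n).1 (e n).2, fun n => b (e n).1 (e n).2, fun x => ?_,
    (e.summable_iff (f := g)).mpr hsum, ?_⟩
  · have hx : Summable fun i : ℕ × ℕ => φ i.1 i.2 x • b i.1 i.2 := by
      refine Summable.of_norm_bounded (hsum1.mul_right ‖x‖) fun i => ?_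
      rw [norm_smul]
      calc _ ≤ ‖φ i.1 i.2‖ * ‖x‖ * ‖b i.1 i.2‖ := by gcongr; exact (φ i.1 i.2).le_opNorm x
        _ = _ := by ring
    have h4 := hx.hasSum.prod_fiberwise fun j => h1 j x
    exact (e.hasSum_iff (f := fun i : ℕ × ℕ => φ i.1 i.2 x • b i.1 i.2)).mpr
      (h4.unique (hT x) ▸ hx.hasSum)
  · exact (e.tsum_eq g).trans_le hle

theorem PNuclearBound.comp {E' F' : Type*} [NormedAddCommGroup E'] [NormedSpace 𝕜 E']
    [NormedAddCommGroup F'] [NormedSpace 𝕜 F'] {p C : ℝ} (hp : 0 < p) {T : E →ₗ[𝕜] F}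
    (h : PNuclearBound p C T) (L : F →L[𝕜] F') (R : E' →L[𝕜] E) :
    PNuclearBound p ((‖L‖ * ‖R‖) ^ p * C) ((L : F →ₗ[𝕜] F') ∘ₗ T ∘ₗ (R : E' →ₗ[𝕜] E)) := by
  obtain ⟨φ, b, h1, h2, h3⟩ := h
  have hle : ∀ n, (‖(φ n).comp R‖ * ‖L (b n)‖) ^ p
      ≤ (‖L‖ * ‖R‖) ^ p * (‖φ n‖ * ‖b n‖) ^ p := fun n => by
    rw [← Real.mul_rpow (by positivity) (by positivity)]
    refine Real.rpow_le_rpow (by positivity) ?_ hp.le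
    calc _ ≤ (‖φ n‖ * ‖R‖) * (‖L‖ * ‖b n‖) := by
          gcongr
          · exact (φ n).opNorm_comp_le R
          · exact L.le_opNorm _
      _ = _ := by ring
  have hs := (h2.mul_left ((‖L‖ * ‖R‖) ^ p)).of_nonneg_of_le (fun n => by positivity) hle
  refine ⟨fun n => (φ n).comp R, fun n => L (b n), fun x => ?_, hs, ?_⟩
  · simpa using (h1 (R x)).mapL L
  · refine (Summable.tsum_le_tsum hle hs (h2.mul_left _)).trans ?_
    rw [tsum_mul_left]
    gcongr

theorem approximationNumber_nonneg (T : E →L[𝕜] F) (n : ℕ) : 0 ≤ approximationNumber T n :=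
  Real.sInf_nonneg (by rintro _ ⟨S, -, rfl⟩; positivity)

theorem approximationNumber_bddBelow (T : E →L[𝕜] F) (n : ℕ) :
    BddBelow {r : ℝ | ∃ S : E →L[𝕜] F, LinearMap.rank (S : E →ₗ[𝕜] F) ≤ n ∧ r = ‖T - S‖} :=
  ⟨0, by rintro _ ⟨S, -, rfl⟩; positivity⟩

theorem approximationNumber_le {T S : E →L[𝕜] F} {n : ℕ}
    (hS : LinearMap.rank (S : E →ₗ[𝕜] F) ≤ n) : approximationNumber T n ≤ ‖T - S‖ :=
  csInf_le (approximationNumber_bddBelow T n) ⟨S, hS, rfl⟩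

theorem exists_norm_sub_lt (T : E →L[𝕜] F) (n : ℕ) {ε : ℝ} (hε : 0 < ε) :
    ∃ S : E →L[𝕜] F, LinearMap.rank (S : E →ₗ[𝕜] F) ≤ n ∧
      ‖T - S‖ < approximationNumber T n + ε := by
  obtain ⟨_, ⟨S, hS, rfl⟩, h⟩ := Real.lt_sInf_add_pos
    (s := {r : ℝ | ∃ S : E →L[𝕜] F, LinearMap.rank (S : E →ₗ[𝕜] F) ≤ n ∧ r = ‖T - S‖})
    ⟨_, 0, by simp, rfl⟩ hε
  exact ⟨S, hS, h⟩

theorem approximationNumber_antitone (T : E →L[𝕜] F) : Antitone (approximationNumber T) := by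
  intro m n hmn
  refine le_csInf ⟨_, 0, by simp, rfl⟩ ?_
  rintro _ ⟨S, hS, rfl⟩
  exact approximationNumber_le (hS.trans (by exact_mod_cast hmn))

/-- A `p`-nuclear map, `p ≤ 1`, is bounded and is the norm limit of the partial sums of a
`p`-nuclear decomposition. -/
theorem IsPNuclear.exists_clm [CompleteSpace F] {p : ℝ} (hp : 0 < p) (hp1 : p ≤ 1)
    {T : E →ₗ[𝕜] F} (h : IsPNuclear p T) :
    ∃ (T' : E →L[𝕜] F) (φ : ℕ → StrongDual 𝕜 E) (b : ℕ → F), (T' : E →ₗ[𝕜] F) = T ∧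
      (Summable fun n => (‖φ n‖ * ‖b n‖) ^ p) ∧
      HasSum (fun n => (φ n).smulRight (b n)) T' := by
  obtain ⟨φ, b, h1, h2⟩ := h
  have h3 : Summable fun n => (‖φ n‖ * ‖b n‖) ^ p :=
    h2.congr fun _ => (Real.mul_rpow (norm_nonneg _) (norm_nonneg _)).symm
  have h4 := summable_of_summable_rpow hp hp1 (fun i => by positivity) h3
  have h5 : Summable fun n => (φ n).smulRight (b n) :=
    Summable.of_norm (h4.congr fun n => by simp)
  refine ⟨∑' n, (φ n).smulRight (b n), φ, b, ?_, h3, h5.hasSum⟩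
  ext x
  have h6 := h5.hasSum.mapL (ContinuousLinearMap.apply 𝕜 F x)
  exact h6.unique (by simpa using h1 x)

theorem rank_sum_smulRight_le {ι : Type*} (s : Finset ι) (φ : ι → StrongDual 𝕜 E) (b : ι → F) :
    LinearMap.rank ((∑ i ∈ s, (φ i).smulRight (b i) : E →L[𝕜] F) : E →ₗ[𝕜] F) ≤ s.card := by
  have hle : LinearMap.range ((∑ i ∈ s, (φ i).smulRight (b i) : E →L[𝕜] F) : E →ₗ[𝕜] F)
      ≤ Submodule.span 𝕜 (Set.range fun i : s => b i) := by
    rintro _ ⟨x, rfl⟩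
    simp only [ContinuousLinearMap.coe_coe, sum_apply,
      ContinuousLinearMap.smulRight_apply]
    exact Submodule.sum_mem _ fun i hi => Submodule.smul_mem _ _
      (Submodule.subset_span ⟨⟨i, hi⟩, rfl⟩)
  have : Module.finrank 𝕜 (Submodule.span 𝕜 (Set.range fun i : s => b i)) ≤ s.card := by
    simpa [Set.finrank] using finrank_range_le_card (R := 𝕜) (fun i : s => b i)
  refine (Submodule.rank_mono hle).trans ?_
  have : FiniteDimensional 𝕜 (Submodule.span 𝕜 (Set.range fun i : s => b i)) :=
    FiniteDimensional.span_of_finite 𝕜 (Set.finite_range _)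
  rw [← Module.finrank_eq_rank]
  exact_mod_cast ‹_›

theorem IsPNuclear.isCompactOperator [CompleteSpace F] {T : E →ₗ[𝕜] F} (h : IsPNuclear 1 T) :
    IsCompactOperator T := by
  obtain ⟨T', φ, b, rfl, -, h2⟩ := h.exists_clm one_pos le_rfl
  refine isCompactOperator_of_tendsto (F := fun s => ∑ i ∈ s, (φ i).smulRight (b i)) h2
    (Filter.Eventually.of_forall fun s => ?_)
  have hc : ∀ i, IsCompactOperator ((φ i).smulRight (b i)) := fun i => by
    have h1 : IsCompactOperator (ContinuousLinearMap.toSpanSingleton 𝕜 (b i)) :=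
      isCompactOperator_of_locallyCompactSpace_rng (ContinuousLinearMap.toSpanSingleton 𝕜 (b i))
    exact h1.comp_clm (φ i)
  induction s using Finset.cons_induction with
  | empty => simpa using isCompactOperator_zero
  | cons i s hi ih =>
    rw [Finset.sum_cons, FunLike.coe_add]
    exact (hc i).add ih

/-- Keep the terms of size above a threshold `ε`: at most `s / ε ^ p` of them exist, and the others
sum to at most `ε ^ (1 - p) * s`. Optimizing `ε` gives the decay `n ^ (-(1 - p) / p)`. -/
theorem IsPNuclear.isEllP [CompleteSpace F] {p q : ℝ} (hp : 0 < p) (hp1 : p < 1)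
    (hq : p / (1 - p) < q) {T : E →ₗ[𝕜] F} (h : IsPNuclear p T) : IsEllP q T := by
  obtain ⟨T', φ, b, hT, h1, h2⟩ := h.exists_clm hp hp1.le
  refine ⟨T', hT, ?_⟩
  have hp1' : 0 < 1 - p := sub_pos.mpr hp1
  have hq0 : 0 < q := (div_pos hp hp1').trans hq
  set c : ℕ → ℝ := fun n => ‖φ n‖ * ‖b n‖ with hc
  have hc0 : ∀ n, 0 ≤ c n := fun n => by positivity
  have hcs : Summable c := summable_of_summable_rpow hp hp1.le hc0 h1
  set s : ℝ := ∑' n, c n ^ p with hs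
  have hs0 : 0 ≤ s := tsum_nonneg fun n => Real.rpow_nonneg (hc0 n) p
  -- the estimate `αₙ ≤ D (n + 1) ^ (-(1 - p) / p)`
  obtain ⟨D, hD0, hD⟩ : ∃ D : ℝ, 0 ≤ D ∧ ∀ n : ℕ, approximationNumber T' (n + 1)
      ≤ D * ((n : ℝ) + 1) ^ (-((1 - p) / p)) := by
    refine ⟨(s + 1) ^ ((1 - p) / p) * s, by positivity, fun n => ?_⟩
    -- This choice leaves at most `n + 1` terms above the threshold; `s + 1` in place of `s` keeps
    -- `ε` positive when every term vanishes.
    set ε : ℝ := ((s + 1) / (n + 1)) ^ (1 / p) with hε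
    have hε0 : 0 < ε := by positivity
    have hεp : ε ^ p = (s + 1) / (n + 1) := by
      rw [hε, ← Real.rpow_mul (by positivity), one_div_mul_cancel hp.ne', Real.rpow_one]
    have hfin : {m | ε < c m}.Finite := by
      have := hcs.tendsto_cofinite_zero.eventually (gt_mem_nhds hε0)
      rw [Filter.eventually_cofinite] at this
      exact this.subset fun m hm => not_lt.mpr (le_of_lt hm)
    set t : Finset ℕ := hfin.toFinset with ht
    have hcard : t.card ≤ n + 1 := by
      have h3 : (t.card : ℝ) * ε ^ p ≤ s := by
        rw [← nsmul_eq_mul]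
        refine (Finset.card_nsmul_le_sum t (fun m => c m ^ p) _ fun m hm => ?_).trans
          (h1.sum_le_tsum t fun m _ => Real.rpow_nonneg (hc0 m) p)
        exact Real.rpow_le_rpow hε0.le (le_of_lt (by simpa [ht] using hm)) hp.le
      rw [hεp, ← mul_div_assoc, div_le_iff₀ (by positivity)] at h3
      have h4 : (t.card : ℝ) * (s + 1) ≤ (n + 1) * (s + 1) := by nlinarith
      have h5 := le_of_mul_le_mul_right h4 (by positivity)
      exact_mod_cast h5
    refine (approximationNumber_le ((rank_sum_smulRight_le t φ b).trans
      (by exact_mod_cast hcard))).trans ?_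
    have hrem : HasSum (fun m : ((t : Set ℕ)ᶜ : Set ℕ) => (φ m).smulRight (b m))
        (T' - ∑ i ∈ t, (φ i).smulRight (b i)) := by
      have := (t.hasSum_compl_iff (f := fun m => (φ m).smulRight (b m))
        (a := T' - ∑ i ∈ t, (φ i).smulRight (b i))).mpr (by simpa using h2)
      exact this
    have hbd : ∀ m : ((t : Set ℕ)ᶜ : Set ℕ), ‖(φ m).smulRight (b m)‖ ≤ ε ^ (1 - p) * c m ^ p := by
      rintro ⟨m, hm⟩
      have hm : c m ≤ ε := by simpa [ht] using hm
      rw [ContinuousLinearMap.norm_smulRight_apply]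
      change c m ≤ _
      rcases (hc0 m).eq_or_lt with h0 | h0
      · rw [← h0, Real.zero_rpow hp.ne', mul_zero]
      · calc c m = c m ^ (1 - p) * c m ^ p := by
              rw [← Real.rpow_add h0, sub_add_cancel, Real.rpow_one]
          _ ≤ _ := by gcongr
    have h6 : Summable fun m : ((t : Set ℕ)ᶜ : Set ℕ) => ε ^ (1 - p) * c m ^ p :=
      (h1.mul_left _).subtype _
    have h7 := tsum_of_norm_bounded h6.hasSum hbd
    rw [hrem.tsum_eq] at h7
    refine h7.trans ?_
    rw [tsum_mul_left]
    have h8 : ε ^ (1 - p) = (s + 1) ^ ((1 - p) / p) * ((n : ℝ) + 1) ^ (-((1 - p) / p)) := by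
      rw [hε, ← Real.rpow_mul (by positivity), Real.div_rpow (by positivity) (by positivity),
        Real.rpow_neg (by positivity), one_div_mul_eq_div]
      rfl
    rw [h8]
    calc _ ≤ (s + 1) ^ ((1 - p) / p) * ((n : ℝ) + 1) ^ (-((1 - p) / p)) * s := by
          gcongr
          exact h1.tsum_subtype_le _ _ fun m => Real.rpow_nonneg (hc0 m) p
      _ = _ := by ring
  rw [← summable_nat_add_iff 1]
  have hr : 1 < (1 - p) / p * q := by
    rw [div_lt_iff₀ hp1'] at hq
    rw [div_mul_eq_mul_div, lt_div_iff₀ hp]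
    linarith
  have hsum : Summable fun n : ℕ => D ^ q * ((n : ℝ) + 1) ^ (-((1 - p) / p * q)) := by
    refine Summable.mul_left _ ?_
    have := (summable_nat_add_iff 1).mpr (Real.summable_nat_rpow.mpr (neg_lt_neg hr))
    exact_mod_cast this
  refine hsum.of_nonneg_of_le (fun n => Real.rpow_nonneg (approximationNumber_nonneg _ _) _)
    fun n => ?_
  calc _ ≤ (D * ((n : ℝ) + 1) ^ (-((1 - p) / p))) ^ q :=
        Real.rpow_le_rpow (approximationNumber_nonneg _ _) (hD n) hq0.le
    _ = _ := by
      rw [Real.mul_rpow hD0 (by positivity), ← Real.rpow_mul (by positivity), neg_mul]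

end

/-! ### From `ℓ^p` to `p`-nuclear for maps into an inner product space. -/

section Hilbert

variable {𝕜 E F : Type*} [RCLike 𝕜] [NormedAddCommGroup E] [NormedSpace 𝕜 E]
  [NormedAddCommGroup F] [InnerProductSpace 𝕜 F]

/-- Expanding in an orthonormal basis of the range costs at most `‖R‖` per basis vector; this is
where the inner product on the target is used. -/
theorem pNuclearBound_of_rank_le {p : ℝ} (hp : 0 < p) (R : E →L[𝕜] F) {r : ℕ}
    (hR : LinearMap.rank (R : E →ₗ[𝕜] F) ≤ r) :
    PNuclearBound p (r * ‖R‖ ^ p) (R : E →ₗ[𝕜] F) := by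
  have hlt : Module.rank 𝕜 (LinearMap.range (R : E →ₗ[𝕜] F)) < Cardinal.aleph0 :=
    lt_of_le_of_lt hR (Cardinal.natCast_lt_aleph0)
  have : FiniteDimensional 𝕜 (LinearMap.range (R : E →ₗ[𝕜] F)) :=
    Module.rank_lt_aleph0_iff.mp hlt
  let e := stdOrthonormalBasis 𝕜 (LinearMap.range (R : E →ₗ[𝕜] F))
  have hr : Module.finrank 𝕜 (LinearMap.range (R : E →ₗ[𝕜] F)) ≤ r := by
    rw [LinearMap.rank, ← Module.finrank_eq_rank] at hR
    exact_mod_cast hR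
  have he : ∀ i, ‖(e i : F)‖ = 1 := fun i => e.orthonormal.1 i
  refine pNuclearBound_of_fintype hp (fun i => (innerSL 𝕜 (e i : F)).comp R)
    (fun i => (e i : F)) (fun x => ?_) ?_
  · have := e.sum_repr' ⟨R x, x, rfl⟩
    have := congrArg Subtype.val this
    simpa using this.symm
  · calc _ ≤ ∑ _ : Fin (Module.finrank 𝕜 (LinearMap.range (R : E →ₗ[𝕜] F))), ‖R‖ ^ p := by
          refine Finset.sum_le_sum fun i _ => Real.rpow_le_rpow (by positivity) ?_ hp.le
          rw [he, mul_one]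
          refine (ContinuousLinearMap.opNorm_comp_le _ _).trans ?_
          rw [innerSL_apply_norm, he, one_mul]
      _ = (Module.finrank 𝕜 (LinearMap.range (R : E →ₗ[𝕜] F)) : ℝ) * ‖R‖ ^ p := by simp
      _ ≤ _ := by gcongr

/-- Near-optimal approximations of rank `2 ^ j` are telescoped. The `j`-th difference has rank of
order `2 ^ j` and norm controlled by the two adjacent errors, and Cauchy condensation makes the
resulting dyadic sum finite. -/
theorem IsEllP.isPNuclear [CompleteSpace F] {p : ℝ} (hp : 0 < p) (hp1 : p ≤ 1) {T : E →ₗ[𝕜] F}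
    (h : IsEllP p T) : IsPNuclear p T := by
  obtain ⟨T, rfl, hT⟩ := h
  -- The slack is chosen so that its `p`-th power is `4⁻ʲ`, which stays summable after
  -- multiplication by the rank `2 ^ j`.
  have hδ : ∀ j : ℕ, 0 < ((1 / 4 : ℝ) ^ j) ^ (1 / p) := fun j => by positivity
  choose S hSr hS using fun j : ℕ => exists_norm_sub_lt T (2 ^ j) (hδ j)
  set α : ℕ → ℝ := approximationNumber T with hα
  have hα0 : ∀ n, 0 ≤ α n := approximationNumber_nonneg T
  have hdyadic : Summable fun j : ℕ => (2 : ℝ) ^ j * α (2 ^ j) ^ p := by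
    refine (summable_condensed_iff_of_nonneg (f := fun n => α n ^ p)
      (fun n => Real.rpow_nonneg (hα0 n) p) fun m n _ hmn => ?_).mpr hT
    exact Real.rpow_le_rpow (hα0 n) (approximationNumber_antitone T hmn) hp.le
  have herr : ∀ j, ‖T - S j‖ ^ p ≤ α (2 ^ j) ^ p + (1 / 4) ^ j := fun j => by
    calc _ ≤ (α (2 ^ j) + ((1 / 4 : ℝ) ^ j) ^ (1 / p)) ^ p :=
          Real.rpow_le_rpow (norm_nonneg _) (hS j).le hp.le
      _ ≤ _ := Real.rpow_add_le_add_rpow (hα0 _) (hδ j).le hp.le hp1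
      _ = _ := by
        rw [← Real.rpow_mul (by positivity), one_div_mul_cancel hp.ne', Real.rpow_one]
  have herrs : Summable fun j : ℕ => (2 : ℝ) ^ j * ‖T - S j‖ ^ p := by
    refine Summable.of_nonneg_of_le (fun j => by positivity)
      (fun j => mul_le_mul_of_nonneg_left (herr j) (by positivity)) ?_
    simp only [mul_add, ← mul_pow]
    exact hdyadic.add (summable_geometric_of_lt_one (by norm_num) (by norm_num))
  have hlim : Filter.Tendsto S Filter.atTop (nhds T) := by
    rw [tendsto_iff_norm_sub_tendsto_zero]
    have h1 : Summable fun j : ℕ => ‖T - S j‖ ^ p :=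
      herrs.of_nonneg_of_le (fun j => by positivity) fun j =>
        le_mul_of_one_le_left (by positivity) (one_le_pow₀ (by norm_num))
    simpa [norm_sub_rev] using
      (summable_of_summable_rpow hp hp1 (fun j => norm_nonneg _) h1).tendsto_atTop_zero
  obtain ⟨R, hR_zero, hR_succ⟩ : ∃ R : ℕ → E →L[𝕜] F,
      R 0 = S 0 ∧ ∀ j, R (j + 1) = S (j + 1) - S j :=
    ⟨fun j => match j with
      | 0 => S 0
      | j + 1 => S (j + 1) - S j, rfl, fun _ => rfl⟩
  have hRsum : ∀ n, ∑ j ∈ Finset.range (n + 1), R j = S n := fun n => by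
    induction n with
    | zero => simp [hR_zero]
    | succ n ih => rw [Finset.sum_range_succ, ih]; simp [hR_succ]
  have hR0 : PNuclearBound p (1 * ‖S 0‖ ^ p) (R 0 : E →ₗ[𝕜] F) := by
    rw [hR_zero]
    simpa using pNuclearBound_of_rank_le hp (S 0) (hSr 0)
  have hR1 : ∀ j, PNuclearBound p ((2 ^ (j + 1) + 2 ^ j : ℕ) *
      (‖T - S (j + 1)‖ ^ p + ‖T - S j‖ ^ p)) ((R (j + 1) : E →L[𝕜] F) : E →ₗ[𝕜] F) := fun j => by
    rw [hR_succ]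
    refine (pNuclearBound_of_rank_le (r := 2 ^ (j + 1) + 2 ^ j) hp (S (j + 1) - S j) ?_).mono ?_
    · have h1 : ((S (j + 1) - S j : E →L[𝕜] F) : E →ₗ[𝕜] F)
          = (S (j + 1) : E →ₗ[𝕜] F) + (-1 : 𝕜) • (S j : E →ₗ[𝕜] F) := by
        ext x; simp [sub_eq_add_neg]
      have h2 : LinearMap.rank ((-1 : 𝕜) • (S j : E →ₗ[𝕜] F)) ≤ (2 ^ j : ℕ) := by
        refine le_trans (Submodule.rank_mono ?_) (hSr j)
        rintro _ ⟨x, rfl⟩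
        exact ⟨-x, by simp⟩
      rw [h1]
      refine (LinearMap.rank_add_le _ _).trans ((add_le_add (hSr (j + 1)) h2).trans ?_)
      norm_cast
    · gcongr
      refine le_trans (Real.rpow_le_rpow (norm_nonneg _) ?_ hp.le)
        (Real.rpow_add_le_add_rpow (norm_nonneg _) (norm_nonneg _) hp.le hp1)
      calc ‖S (j + 1) - S j‖ = ‖(T - S j) - (T - S (j + 1))‖ := by congr 1; abel
        _ ≤ ‖T - S j‖ + ‖T - S (j + 1)‖ := norm_sub_le _ _
        _ = _ := add_comm _ _
  let C : ℕ → ℝ := fun j => Nat.casesOn j (1 * ‖S 0‖ ^ p) fun j => (2 ^ (j + 1) + 2 ^ j : ℕ) *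
      (‖T - S (j + 1)‖ ^ p + ‖T - S j‖ ^ p)
  have hRC : ∀ j, PNuclearBound p (C j) (R j : E →ₗ[𝕜] F) := fun j => by
    cases j with
    | zero => exact hR0
    | succ j => exact hR1 j
  have hC : Summable C := by
    rw [← summable_nat_add_iff 1]
    -- The rank bound `2 ^ (j + 1) + 2 ^ j` equals `(3 / 2) * 2 ^ (j + 1)` against the error at `j +
    -- 1`, and `3 * 2 ^ j` against the error at `j`.
    have h1 := ((summable_nat_add_iff 1).mpr herrs).mul_left (3 / 2)
    refine (h1.add (herrs.mul_left 3)).congr fun j => ?_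
    simp only [C]
    push_cast
    ring
  refine (pNuclearBound_of_hasSum (S := fun j => (R j : E →ₗ[𝕜] F)) hp hp1 hRC hC fun x => ?_).isPNuclear
  have hRs : Summable fun j => R j x := by
    refine Summable.of_norm ?_
    have h2 : ∀ j, ‖R j‖ ^ p ≤ C j := fun j => by
      cases j with
      | zero => simp [hR_zero, C]
      | succ j =>
        have h3 : ‖S (j + 1) - S j‖ ^ p ≤ ‖T - S (j + 1)‖ ^ p + ‖T - S j‖ ^ p := by
          refine le_trans (Real.rpow_le_rpow (norm_nonneg _) ?_ hp.le)
            (Real.rpow_add_le_add_rpow (norm_nonneg _) (norm_nonneg _) hp.le hp1)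
          calc ‖S (j + 1) - S j‖ = ‖(T - S j) - (T - S (j + 1))‖ := by congr 1; abel
            _ ≤ ‖T - S j‖ + ‖T - S (j + 1)‖ := norm_sub_le _ _
            _ = _ := add_comm _ _
        rw [hR_succ]
        refine h3.trans (le_mul_of_one_le_left (by positivity) ?_)
        exact_mod_cast Nat.le_add_right_of_le Nat.one_le_two_pow
    have h4 := summable_of_summable_rpow hp hp1 (fun j => norm_nonneg _)
      (hC.of_nonneg_of_le (fun j => by positivity) h2)
    exact (h4.mul_right ‖x‖).of_nonneg_of_le (fun j => norm_nonneg _) fun j => (R j).le_opNorm x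
  have h5 := (hRs.hasSum.tendsto_sum_nat).comp (Filter.tendsto_add_atTop_nat 1)
  have h6 : Filter.Tendsto (fun n => S n x) Filter.atTop (nhds (T x)) :=
    ((ContinuousLinearMap.apply 𝕜 F x).continuous.tendsto T).comp hlim
  have h7 : ∑' j, R j x = T x := by
    refine tendsto_nhds_unique h5 (h6.congr fun n => ?_)
    rw [← hRsum n]
    simp
  exact h7 ▸ hRs.hasSum

end Hilbert

end BanachIdeal

/-! ### Canonical anticommutation relations on the Fock space. -/

namespace FermiFock

open scoped ComplexInnerProductSpace

variable {𝓗 : Type*} [NormedAddCommGroup 𝓗] [InnerProductSpace ℂ 𝓗]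

/-- The embedding of the exterior algebra into the Fock space. -/
noncomputable def toFock : ExteriorAlgebra ℂ 𝓗 →ₗᵢ[ℂ] FermiFockSpace 𝓗 :=
  UniformSpace.Completion.toComplₗᵢ

theorem denseRange_toFock : DenseRange (toFock (𝓗 := 𝓗)) :=
  UniformSpace.Completion.denseRange_coe

theorem clm_ext {S T : FermiFockSpace 𝓗 →L[ℂ] FermiFockSpace 𝓗}
    (h : ∀ x, S (toFock x) = T (toFock x)) : S = T :=
  DFunLike.coe_injective (denseRange_toFock.equalizer S.continuous T.continuous (funext h))

theorem vacuum_eq : vacuum 𝓗 = toFock 1 := rfl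

theorem exteriorMap_apply {D : Submodule ℂ 𝓗} (T : D →ₗ[ℂ] 𝓗) (x : ExteriorAlgebra ℂ D) :
    exteriorMap T x = toFock (ExteriorAlgebra.map T x) := rfl

theorem inner_vacuum_vacuum : ⟪vacuum 𝓗, vacuum 𝓗⟫ = 1 := by
  rw [vacuum_eq, LinearIsometry.inner_map_map, inner_one_one]

theorem creation_toFock (f : 𝓗) (x : ExteriorAlgebra ℂ 𝓗) :
    creation f (toFock x) = toFock (ExteriorAlgebra.ι ℂ f * x) :=
  ContinuousLinearMap.completion_apply_coe _ x

theorem inner_creation_left (f : 𝓗) (x y : FermiFockSpace 𝓗) :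
    ⟪creation f x, y⟫ = ⟪x, annihilation f y⟫ :=
  (ContinuousLinearMap.adjoint_inner_right _ _ _).symm

theorem inner_annihilation_left (f : 𝓗) (x y : FermiFockSpace 𝓗) :
    ⟪annihilation f x, y⟫ = ⟪x, creation f y⟫ :=
  ContinuousLinearMap.adjoint_inner_left _ _ _

theorem annihilation_toFock (f : 𝓗) (x : ExteriorAlgebra ℂ 𝓗) :
    annihilation f (toFock x) = toFock (contract f x) := by
  refine ext_inner_left ℂ fun y => ?_
  induction y using denseRange_toFock.induction_on with
  | hp => exact isClosed_eq (by fun_prop) (by fun_prop)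
  | ih y =>
    rw [← inner_creation_left, creation_toFock, LinearIsometry.inner_map_map,
      LinearIsometry.inner_map_map, inner_ι_mul]

theorem norm_creation_le (f : 𝓗) : ‖creation f‖ ≤ ‖f‖ := by
  refine ContinuousLinearMap.opNorm_le_bound _ (norm_nonneg _) fun x => ?_
  induction x using denseRange_toFock.induction_on with
  | hp => exact isClosed_le (by fun_prop) (by fun_prop)
  | ih x =>
    rw [creation_toFock, LinearIsometry.norm_map, LinearIsometry.norm_map]
    exact norm_ι_mul_le f x

theorem norm_annihilation_le (f : 𝓗) : ‖annihilation f‖ ≤ ‖f‖ := by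
  rw [annihilation, LinearIsometryEquiv.norm_map]
  exact norm_creation_le f

theorem norm_field_le (f : 𝓗) : ‖field f‖ ≤ 2 * ‖f‖ :=
  (norm_add_le _ _).trans (by linarith [norm_creation_le f, norm_annihilation_le f])

theorem creation_add (f g : 𝓗) : creation (f + g) = creation f + creation g :=
  clm_ext fun x => by
    rw [add_apply]
    simp only [creation_toFock, map_add, add_mul]

theorem creation_smul (c : ℂ) (f : 𝓗) : creation (c • f) = c • creation f :=
  clm_ext fun x => by
    rw [smul_apply]
    simp only [creation_toFock, map_smul, smul_mul_assoc]

theorem field_add (f g : 𝓗) : field (f + g) = field f + field g := by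
  simp only [field, annihilation, creation_add, map_add]
  abel

theorem field_real_smul (c : ℝ) (f : 𝓗) : field (c • f) = (c : ℂ) • field f := by
  rw [← Complex.coe_smul, field, field, annihilation, annihilation, creation_smul, map_smulₛₗ,
    Complex.conj_ofReal, smul_add]

theorem creation_vacuum (f : 𝓗) : creation f (vacuum 𝓗) = toFock (ExteriorAlgebra.ι ℂ f) := by
  rw [vacuum_eq, creation_toFock, mul_one]

theorem annihilation_vacuum (f : 𝓗) : annihilation f (vacuum 𝓗) = 0 := by
  rw [vacuum_eq, annihilation_toFock]
  have := contract_algebraMap f (1 : ℂ)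
  rw [map_one] at this
  rw [this, map_zero]

theorem field_vacuum (f : 𝓗) : field f (vacuum 𝓗) = toFock (ExteriorAlgebra.ι ℂ f) := by
  rw [field, add_apply, annihilation_vacuum, creation_vacuum, add_zero]

theorem annihilation_mul_creation (f g : 𝓗) :
    annihilation f * creation g + creation g * annihilation f = ⟪f, g⟫ • 1 :=
  clm_ext fun x => by
    rw [add_apply, smul_apply]
    simp only [mul_apply_eq_comp, one_apply_eq_self, creation_toFock,
      annihilation_toFock, contract_ι_mul, map_sub, map_smul]
    abel

theorem creation_mul_creation (f g : 𝓗) :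
    creation f * creation g + creation g * creation f = 0 :=
  clm_ext fun x => by
    rw [add_apply]
    simp only [mul_apply_eq_comp, creation_toFock, ← map_add, ← mul_assoc, ← add_mul]
    rw [ExteriorAlgebra.ι_add_mul_swap]
    simp

theorem annihilation_mul_annihilation (f g : 𝓗) :
    annihilation f * annihilation g + annihilation g * annihilation f = 0 := by
  have h := congrArg star (creation_mul_creation g f)
  simpa [annihilation, ← ContinuousLinearMap.star_eq_adjoint] using h

theorem annihilation_mul_field (f g : 𝓗) :
    annihilation f * field g + field g * annihilation f = ⟪f, g⟫ • 1 := by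
  have h1 := annihilation_mul_creation f g
  have h2 := annihilation_mul_annihilation f g
  rw [field]
  calc _ = (annihilation f * creation g + creation g * annihilation f)
        + (annihilation f * annihilation g + annihilation g * annihilation f) := by noncomm_ring
    _ = _ := by rw [h1, h2, add_zero]

/-- The two mixed anticommutators contribute complex conjugate scalars, so only the real scalar
product of `f` and `g` survives. -/
theorem field_mul_field (f g : 𝓗) :
    field f * field g + field g * field f = (2 * (⟪f, g⟫.re : ℂ)) • 1 := by
  have h1 := annihilation_mul_field f g
  have h2 := annihilation_mul_creation g f
  have h3 := creation_mul_creation f g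
  calc field f * field g + field g * field f
      = (annihilation f * field g + field g * annihilation f)
        + (annihilation g * creation f + creation f * annihilation g)
        + (creation f * creation g + creation g * creation f) := by
        rw [field, field]; noncomm_ring
    _ = _ := by
      rw [h1, h2, h3, add_zero, ← add_smul]
      congr 1
      rw [← inner_conj_symm g f, Complex.add_conj]
      simp

/-! ### Parity -/

theorem contract_involute (f : 𝓗) (x : ExteriorAlgebra ℂ 𝓗) :
    contract f (CliffordAlgebra.involute x) = -CliffordAlgebra.involute (contract f x) := by
  induction x using CliffordAlgebra.left_induction with
  | algebraMap r =>
    rw [AlgHom.commutes]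
    erw [contract_algebraMap]
    simp
  | add x y hx hy => simp only [map_add, hx, hy]; abel
  | ι_mul x m ih =>
    rw [map_mul, CliffordAlgebra.involute_ι, neg_mul, map_neg]
    erw [contract_ι_mul, contract_ι_mul]
    rw [ih, map_sub, map_smul, map_mul]
    erw [CliffordAlgebra.involute_ι]
    simp [ExteriorAlgebra.ι]

theorem algebraMapInv_involute (x : ExteriorAlgebra ℂ 𝓗) :
    ExteriorAlgebra.algebraMapInv (CliffordAlgebra.involute x : ExteriorAlgebra ℂ 𝓗)
      = ExteriorAlgebra.algebraMapInv x := by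
  have : (ExteriorAlgebra.algebraMapInv (R := ℂ) (M := 𝓗)).comp CliffordAlgebra.involute
      = ExteriorAlgebra.algebraMapInv := by
    refine ExteriorAlgebra.hom_ext ?_
    ext f
    have h := CliffordAlgebra.involute_ι (Q := (0 : QuadraticForm ℂ 𝓗)) f
    simp only [LinearMap.comp_apply, AlgHom.toLinearMap_apply, AlgHom.comp_apply]
    erw [h]
    simp [ExteriorAlgebra.algebraMapInv]
  exact DFunLike.congr_fun this x

/-- Wedging and contraction both anticommute with the involution, so moving a factor across the form
produces two signs that cancel. Parity is therefore isometric and extends to the completion. -/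
theorem form_involute (x y : ExteriorAlgebra ℂ 𝓗) :
    form (CliffordAlgebra.involute x) (CliffordAlgebra.involute y) = form x y := by
  induction x using CliffordAlgebra.left_induction generalizing y with
  | algebraMap r =>
    rw [AlgHom.commutes]
    erw [form_algebraMap, form_algebraMap, algebraMapInv_involute]
  | add x₁ x₂ h₁ h₂ => simp only [map_add, LinearMap.add_apply, h₁, h₂]
  | ι_mul x m ih =>
    rw [map_mul, CliffordAlgebra.involute_ι, neg_mul, map_neg, LinearMap.neg_apply]
    erw [form_ι_mul, form_ι_mul]
    rw [contract_involute, map_neg, neg_neg, ih]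

/-- The parity operator `(-1)^N` on the Fock space. -/
noncomputable def parity (𝓗 : Type*) [NormedAddCommGroup 𝓗] [InnerProductSpace ℂ 𝓗] :
    FermiFockSpace 𝓗 →L[ℂ] FermiFockSpace 𝓗 :=
  ((CliffordAlgebra.involute (Q := (0 : QuadraticForm ℂ 𝓗))).toLinearMap.isometryOfInner
    fun x y => form_involute y x : ExteriorAlgebra ℂ 𝓗 →ₗᵢ[ℂ] ExteriorAlgebra ℂ 𝓗)
    |>.toContinuousLinearMap.completion

theorem parity_toFock (x : ExteriorAlgebra ℂ 𝓗) :
    parity 𝓗 (toFock x) = toFock (CliffordAlgebra.involute x : ExteriorAlgebra ℂ 𝓗) :=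
  ContinuousLinearMap.completion_apply_coe _ x

theorem norm_parity_le : ‖parity 𝓗‖ ≤ 1 := by
  refine ContinuousLinearMap.opNorm_le_bound _ zero_le_one fun x => ?_
  induction x using denseRange_toFock.induction_on with
  | hp => exact isClosed_le (by fun_prop) (by fun_prop)
  | ih x =>
    rw [parity_toFock, LinearIsometry.norm_map, LinearIsometry.norm_map, one_mul]
    exact (((CliffordAlgebra.involute (Q := (0 : QuadraticForm ℂ 𝓗))).toLinearMap.isometryOfInner
      fun x y => form_involute y x : ExteriorAlgebra ℂ 𝓗 →ₗᵢ[ℂ] ExteriorAlgebra ℂ 𝓗).norm_map x).le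

theorem parity_mul_parity : parity 𝓗 * parity 𝓗 = 1 :=
  clm_ext fun x => by
    simp only [mul_apply_eq_comp, one_apply_eq_self, parity_toFock]
    erw [CliffordAlgebra.involute_involute]

theorem parity_mul_creation (f : 𝓗) : parity 𝓗 * creation f = -(creation f * parity 𝓗) :=
  clm_ext fun x => by
    rw [neg_apply]
    simp only [mul_apply_eq_comp, parity_toFock, creation_toFock, ← map_neg]
    rw [map_mul]
    erw [CliffordAlgebra.involute_ι]
    rw [neg_mul]

theorem parity_mul_annihilation (f : 𝓗) :
    parity 𝓗 * annihilation f = -(annihilation f * parity 𝓗) :=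
  clm_ext fun x => by
    rw [neg_apply]
    simp only [mul_apply_eq_comp, parity_toFock, annihilation_toFock,
      contract_involute, map_neg, neg_neg]

theorem parity_mul_field (f : 𝓗) : parity 𝓗 * field f = -(field f * parity 𝓗) := by
  rw [field, mul_add, parity_mul_creation, parity_mul_annihilation, add_mul, neg_add]

/-- The grading automorphism `A ↦ Γ A Γ` of the bounded operators on the Fock space. -/
noncomputable def grading (A : FermiFockSpace 𝓗 →L[ℂ] FermiFockSpace 𝓗) :
    FermiFockSpace 𝓗 →L[ℂ] FermiFockSpace 𝓗 := parity 𝓗 * A * parity 𝓗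

theorem grading_mul (A B : FermiFockSpace 𝓗 →L[ℂ] FermiFockSpace 𝓗) :
    grading (A * B) = grading A * grading B := by
  calc grading (A * B) = parity 𝓗 * A * 1 * B * parity 𝓗 := by
        simp only [grading, mul_assoc, one_mul]
    _ = _ := by rw [← parity_mul_parity]; simp only [grading, mul_assoc]

theorem grading_grading (A : FermiFockSpace 𝓗 →L[ℂ] FermiFockSpace 𝓗) :
    grading (grading A) = A := by
  simp only [grading, ← mul_assoc, parity_mul_parity, one_mul]
  rw [mul_assoc, parity_mul_parity, mul_one]

theorem grading_sub (A B : FermiFockSpace 𝓗 →L[ℂ] FermiFockSpace 𝓗) :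
    grading (A - B) = grading A - grading B := by
  simp only [grading, mul_sub, sub_mul]

theorem grading_smul (c : ℂ) (A : FermiFockSpace 𝓗 →L[ℂ] FermiFockSpace 𝓗) :
    grading (c • A) = c • grading A := by
  simp only [grading, mul_smul_comm, smul_mul_assoc]

theorem grading_field (f : 𝓗) : grading (field f) = -field f := by
  rw [grading, parity_mul_field, neg_mul, mul_assoc, parity_mul_parity, mul_one]

/-- The graded derivation `A ↦ (B A - γ(A) B) / 2` of the bounded operators on the Fock space
determined by an odd operator `B`. -/
noncomputable def gradedDerivation (B : FermiFockSpace 𝓗 →L[ℂ] FermiFockSpace 𝓗) :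
    (FermiFockSpace 𝓗 →L[ℂ] FermiFockSpace 𝓗) →L[ℂ] (FermiFockSpace 𝓗 →L[ℂ] FermiFockSpace 𝓗) :=
  LinearMap.mkContinuous
    { toFun := fun A => (1 / 2 : ℂ) • (B * A - grading A * B)
      map_add' := fun A A' => by
        simp only [grading, mul_add, add_mul, ← smul_add]
        congr 1
        abel
      map_smul' := fun c A => by
        simp only [grading_smul, mul_smul_comm, smul_mul_assoc, ← smul_sub, RingHom.id_apply]
        rw [smul_comm] }
    ‖B‖ fun A => by
      have h1 : ‖grading A‖ ≤ ‖A‖ := by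
        calc _ ≤ ‖parity 𝓗‖ * ‖A‖ * ‖parity 𝓗‖ :=
              (norm_mul_le _ _).trans (by gcongr; exact norm_mul_le _ _)
          _ ≤ 1 * ‖A‖ * 1 := by gcongr <;> exact norm_parity_le
          _ = _ := by ring
      have h2 : ‖B * A - grading A * B‖ ≤ ‖B‖ * ‖A‖ + ‖A‖ * ‖B‖ :=
        (norm_sub_le _ _).trans (add_le_add (norm_mul_le _ _)
          ((norm_mul_le _ _).trans (by gcongr)))
      change ‖(1 / 2 : ℂ) • (B * A - grading A * B)‖ ≤ _
      rw [norm_smul]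
      norm_num
      linarith

theorem gradedDerivation_apply (B A : FermiFockSpace 𝓗 →L[ℂ] FermiFockSpace 𝓗) :
    gradedDerivation B A = (1 / 2 : ℂ) • (B * A - grading A * B) := rfl

theorem norm_gradedDerivation_le (B : FermiFockSpace 𝓗 →L[ℂ] FermiFockSpace 𝓗) :
    ‖gradedDerivation B‖ ≤ ‖B‖ :=
  LinearMap.mkContinuous_norm_le _ (norm_nonneg _) _

theorem hasSum_gradedDerivation {ι : Type*} {c : ι → ℂ}
    {B : ι → FermiFockSpace 𝓗 →L[ℂ] FermiFockSpace 𝓗} {S : FermiFockSpace 𝓗 →L[ℂ] FermiFockSpace 𝓗}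
    (h : HasSum (fun i => c i • B i) S) (A : FermiFockSpace 𝓗 →L[ℂ] FermiFockSpace 𝓗) :
    HasSum (fun i => c i • gradedDerivation (B i) A) (gradedDerivation S A) := by
  have h' := ((h.mul_right A).sub (h.mul_left (grading A))).const_smul (1 / 2 : ℂ)
  have : (fun i => c i • gradedDerivation (B i) A)
      = fun i => (1 / 2 : ℂ) • (c i • B i * A - grading A * c i • B i) := funext fun i => by
    rw [gradedDerivation_apply, smul_mul_assoc, mul_smul_comm, ← smul_sub, smul_comm]
  rw [this]
  exact h'

/-- In the sum of the two compositions the terms containing `γ(A)` cancel because `B` and `C` are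
odd. What remains is a multiple of the commutator of `B C + C B` with `A`, which vanishes since that
anticommutator is scalar. -/
theorem gradedDerivation_anticomm {B C : FermiFockSpace 𝓗 →L[ℂ] FermiFockSpace 𝓗}
    (hB : grading B = -B) (hC : grading C = -C) {c : ℂ} (h : B * C + C * B = c • 1)
    (A : FermiFockSpace 𝓗 →L[ℂ] FermiFockSpace 𝓗) :
    gradedDerivation B (gradedDerivation C A) = -gradedDerivation C (gradedDerivation B A) := by
  set G := grading A with hG
  have h1 : (B * C + C * B) * A = A * (B * C + C * B) := by
    rw [h, smul_mul_assoc, mul_smul_comm, one_mul, mul_one]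
  have h2 : (B * (C * A - G * C) - (-C * G - A * -C) * B)
      + (C * (B * A - G * B) - (-B * G - A * -B) * C)
      = (B * C + C * B) * A - A * (B * C + C * B) := by noncomm_ring
  rw [h1, sub_self] at h2
  rw [eq_neg_iff_add_eq_zero]
  simp only [gradedDerivation_apply, grading_smul, grading_sub, grading_mul, ← hG, hB, hC,
    mul_smul_comm, smul_mul_assoc, ← smul_sub, ← smul_add]
  have h3 : grading G = A := grading_grading A
  rw [h3, h2, smul_zero, smul_zero]

end FermiFock

/-! ### The particle-number expansion and its nuclear bounds. -/

open BanachIdeal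

theorem summable_pow_div_factorial_rpow {x p : ℝ} (hx : 0 ≤ x) (hp : 0 < p) :
    Summable fun n : ℕ => (x ^ n / n.factorial) ^ p := by
  -- Enlarging `x` by `2 ^ (1 / p)` frees a factor `2⁻ⁿ` after taking `p`-th powers, while `y ^ n /
  -- n!` stays below `exp y`.
  set y : ℝ := 2 ^ (1 / p) * x with hy
  have hy0 : 0 ≤ y := by positivity
  refine Summable.of_nonneg_of_le (fun n => by positivity) (fun n => ?_)
    ((summable_geometric_of_lt_one (r := (1 / 2 : ℝ)) (by norm_num) (by norm_num)).mul_left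
      (Real.exp y ^ p))
  have h1 : x ^ n / n.factorial = (y ^ n / n.factorial) * (2 ^ (-(1 / p)) : ℝ) ^ n := by
    rw [hy, mul_pow, Real.rpow_neg zero_le_two, inv_pow]
    field_simp
  have h2 : (((2 : ℝ) ^ (-(1 / p))) ^ n) ^ p = (1 / 2) ^ n := by
    rw [← Real.rpow_natCast, ← Real.rpow_mul zero_le_two, ← Real.rpow_mul zero_le_two,
      ← Real.rpow_natCast, show (1 / 2 : ℝ) = 2⁻¹ by norm_num, Real.inv_rpow zero_le_two,
      ← Real.rpow_neg zero_le_two]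
    congr 1
    field_simp
  rw [h1, Real.mul_rpow (by positivity) (by positivity), h2]
  gcongr
  exact Real.pow_div_factorial_le_exp y hy0 n

section

variable {E F : Type*} [NormedAddCommGroup E] [NormedSpace ℂ E] [NormedAddCommGroup F]
  [NormedSpace ℂ F]

theorem ContinuousLinearMap.summable_of_norm_le [CompleteSpace F] {f : ℕ → E →L[ℂ] F} {g : ℕ → ℝ}
    (hg : Summable g) (h : ∀ k, ‖f k‖ ≤ g k) : Summable f :=
  Summable.of_norm_bounded hg h

theorem ContinuousLinearMap.norm_tsum_le {f : ℕ → E →L[ℂ] F} {g : ℕ → ℝ} {a : ℝ}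
    (hg : HasSum g a) (h : ∀ k, ‖f k‖ ≤ g k) : ‖∑' k, f k‖ ≤ a :=
  tsum_of_norm_bounded hg h

theorem ContinuousLinearMap.norm_smul_eq (c : ℂ) (T : E →L[ℂ] F) : ‖c • T‖ = ‖c‖ * ‖T‖ :=
  norm_smul c T

end

namespace FermiFock

open scoped ComplexInnerProductSpace

variable {𝓗 : Type*} [NormedAddCommGroup 𝓗] [InnerProductSpace ℂ 𝓗]

/-- The operator `A ↦ ⟪Ω, A Ω⟫ Ω`. -/
noncomputable def vacuumComponent (𝓗 : Type*) [NormedAddCommGroup 𝓗] [InnerProductSpace ℂ 𝓗] :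
    (FermiFockSpace 𝓗 →L[ℂ] FermiFockSpace 𝓗) →L[ℂ] FermiFockSpace 𝓗 :=
  ((innerSL ℂ (vacuum 𝓗)).comp
    (ContinuousLinearMap.apply ℂ (FermiFockSpace 𝓗) (vacuum 𝓗))).smulRight (vacuum 𝓗)

theorem vacuumComponent_apply (A : FermiFockSpace 𝓗 →L[ℂ] FermiFockSpace 𝓗) :
    vacuumComponent 𝓗 A = ⟪vacuum 𝓗, A (vacuum 𝓗)⟫ • vacuum 𝓗 := rfl

/-- `A ↦ b ∧ S (∂ᵤ A)`. -/
noncomputable def raise (u b : 𝓗)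
    (S : (FermiFockSpace 𝓗 →L[ℂ] FermiFockSpace 𝓗) →L[ℂ] FermiFockSpace 𝓗) :
    (FermiFockSpace 𝓗 →L[ℂ] FermiFockSpace 𝓗) →L[ℂ] FermiFockSpace 𝓗 :=
  (creation b).comp (S.comp (gradedDerivation (field u)))

theorem norm_gradedDerivation_field_le (u : 𝓗) : ‖gradedDerivation (field u)‖ ≤ 2 * ‖u‖ :=
  (norm_gradedDerivation_le _).trans (norm_field_le u)

theorem norm_raise_le (u b : 𝓗)
    (S : (FermiFockSpace 𝓗 →L[ℂ] FermiFockSpace 𝓗) →L[ℂ] FermiFockSpace 𝓗) :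
    ‖raise u b S‖ ≤ ‖u‖ * ‖b‖ * (2 * ‖S‖) := by
  calc ‖raise u b S‖ ≤ ‖creation b‖ * (‖S‖ * ‖gradedDerivation (field u)‖) :=
        (ContinuousLinearMap.opNorm_comp_le _ _).trans
          (by gcongr; exact ContinuousLinearMap.opNorm_comp_le _ _)
    _ ≤ ‖b‖ * (‖S‖ * (2 * ‖u‖)) := by
        gcongr
        · exact norm_creation_le b
        · exact norm_gradedDerivation_field_le u
    _ = _ := by ring

/-- The `n`-particle component of the map `A ↦ X A Ω`, where `X` is the second quantization of an
operator that is given by `h ↦ ∑ₖ re ⟪uₖ, h⟫ bₖ` on a real subspace. -/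
noncomputable def component (u b : ℕ → 𝓗) :
    ℕ → ((FermiFockSpace 𝓗 →L[ℂ] FermiFockSpace 𝓗) →L[ℂ] FermiFockSpace 𝓗)
  | 0 => vacuumComponent 𝓗
  -- Annihilating and recreating each particle in turn yields an `(n + 1)`-particle vector `n + 1`
  -- times, whence the normalization.
  | n + 1 => ((n : ℂ) + 1)⁻¹ • ∑' k, raise (u k) (b k) (component u b n)

variable {u b : ℕ → 𝓗}

theorem summable_raise (hub : Summable fun k => ‖u k‖ * ‖b k‖)
    (S : (FermiFockSpace 𝓗 →L[ℂ] FermiFockSpace 𝓗) →L[ℂ] FermiFockSpace 𝓗) :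
    Summable fun k => raise (u k) (b k) S :=
  ContinuousLinearMap.summable_of_norm_le (hub.mul_right _) fun k => norm_raise_le (u k) (b k) S

theorem hasSum_raise (hub : Summable fun k => ‖u k‖ * ‖b k‖) (n : ℕ) :
    HasSum (fun k => raise (u k) (b k) (component u b n))
      (((n : ℂ) + 1) • component u b (n + 1)) := by
  rw [component, smul_smul, mul_inv_cancel₀ (Nat.cast_add_one_ne_zero n), one_smul]
  exact (summable_raise hub _).hasSum

theorem hasSum_raise_apply (hub : Summable fun k => ‖u k‖ * ‖b k‖) (n : ℕ)
    (A : FermiFockSpace 𝓗 →L[ℂ] FermiFockSpace 𝓗) :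
    HasSum (fun k => creation (b k) (component u b n (gradedDerivation (field (u k)) A)))
      (((n : ℂ) + 1) • component u b (n + 1) A) :=
  (hasSum_raise hub n).mapL (ContinuousLinearMap.apply ℂ (FermiFockSpace 𝓗) A)

/-- The normalizations multiply to `1 / n!`. The factor `2` per step comes from the crude estimate
`‖Φ[u]‖ ≤ 2 ‖u‖`; the factorial absorbs any such constant. -/
theorem norm_component_le (hub : Summable fun k => ‖u k‖ * ‖b k‖) (n : ℕ) :
    ‖component u b n‖
      ≤ (2 * ∑' k, ‖u k‖ * ‖b k‖) ^ n / n.factorial * ‖vacuumComponent 𝓗‖ := by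
  have hs : 0 ≤ ∑' k, ‖u k‖ * ‖b k‖ := tsum_nonneg fun k => by positivity
  induction n with
  | zero => simp [component]
  | succ n ih =>
    have h1 : ‖∑' k, raise (u k) (b k) (component u b n)‖
        ≤ (∑' k, ‖u k‖ * ‖b k‖) * (2 * ‖component u b n‖) :=
      ContinuousLinearMap.norm_tsum_le (hub.hasSum.mul_right _) fun k => norm_raise_le (u k) (b k) _
    have h2 : ‖((n : ℂ) + 1)⁻¹‖ = ((n : ℝ) + 1)⁻¹ := by
      rw [norm_inv]
      congr 1
      exact_mod_cast Complex.norm_natCast (n + 1)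
    rw [component, ContinuousLinearMap.norm_smul_eq, h2]
    calc _ ≤ ((n : ℝ) + 1)⁻¹ * ((∑' k, ‖u k‖ * ‖b k‖) * (2 *
          ((2 * ∑' k, ‖u k‖ * ‖b k‖) ^ n / n.factorial * ‖vacuumComponent 𝓗‖))) := by
            refine mul_le_mul_of_nonneg_left (h1.trans ?_) (by positivity)
            gcongr
      _ = _ := by
        rw [Nat.factorial_succ, pow_succ]
        push_cast
        field_simp

theorem pNuclearBound_vacuumComponent {p : ℝ} (hp : 0 < p) :
    ∃ C, PNuclearBound p C (vacuumComponent 𝓗).toLinearMap :=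
  ⟨_, pNuclearBound_of_fintype (ι := Unit) hp
    (fun _ => (innerSL ℂ (vacuum 𝓗)).comp
      (ContinuousLinearMap.apply ℂ (FermiFockSpace 𝓗) (vacuum 𝓗)))
    (fun _ => vacuum 𝓗) (fun A => by simp [vacuumComponent_apply]) le_rfl⟩

/-- The same recursion run on `p`-th power sums: one step costs `(x / (n + 1)) ^ p`. Hence these
bounds can again be summed over `n`. -/
theorem pNuclearBound_component {p : ℝ} (hp : 0 < p) (hp1 : p ≤ 1)
    (hub : Summable fun k => (‖u k‖ * ‖b k‖) ^ p) {C x : ℝ}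
    (hC : PNuclearBound p C (vacuumComponent 𝓗).toLinearMap)
    (hx0 : 0 ≤ x) (hx : x ^ p = 2 ^ p * ∑' k, (‖u k‖ * ‖b k‖) ^ p) (n : ℕ) :
    PNuclearBound p ((x ^ n / n.factorial) ^ p * C) (component u b n).toLinearMap := by
  have hub1 : Summable fun k => ‖u k‖ * ‖b k‖ :=
    summable_of_summable_rpow hp hp1 (fun k => by positivity) hub
  induction n with
  | zero => simpa [component] using hC
  | succ n ih =>
    set D := (x ^ n / n.factorial) ^ p * C with hD
    have hD0 : 0 ≤ D := ih.nonneg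
    have h1 : ∀ k, PNuclearBound p ((((n : ℝ) + 1)⁻¹ * 2) ^ p * (‖u k‖ * ‖b k‖) ^ p * D)
        (((n : ℂ) + 1)⁻¹ • raise (u k) (b k) (component u b n)).toLinearMap := fun k => by
      refine (ih.comp hp (((n : ℂ) + 1)⁻¹ • creation (b k))
        (gradedDerivation (field (u k)))).mono ?_
      rw [← Real.mul_rpow (by positivity) (by positivity)]
      refine mul_le_mul_of_nonneg_right (Real.rpow_le_rpow (by positivity) ?_ hp.le) hD0
      have h2 : ‖((n : ℂ) + 1)⁻¹‖ = ((n : ℝ) + 1)⁻¹ := by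
        rw [norm_inv]
        congr 1
        exact_mod_cast Complex.norm_natCast (n + 1)
      rw [norm_smul, h2]
      calc _ ≤ ((n : ℝ) + 1)⁻¹ * ‖b k‖ * (2 * ‖u k‖) := by
            gcongr
            · exact norm_creation_le _
            · exact norm_gradedDerivation_field_le _
        _ = _ := by ring
    have h3 := pNuclearBound_of_hasSum (T := (component u b (n + 1)).toLinearMap) hp hp1 h1
      ((hub.mul_left _).mul_right D) fun A => by
        have := (hasSum_raise_apply hub1 n A).const_smul ((n : ℂ) + 1)⁻¹
        rw [smul_smul, inv_mul_cancel₀ (Nat.cast_add_one_ne_zero n), one_smul] at this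
        exact this
    refine h3.mono (le_of_eq ?_)
    have h4 : (x ^ (n + 1) / (n + 1).factorial) ^ p
        = (((n : ℝ) + 1)⁻¹) ^ p * x ^ p * (x ^ n / n.factorial) ^ p := by
      rw [← Real.mul_rpow (by positivity) (by positivity),
        ← Real.mul_rpow (by positivity) (by positivity)]
      congr 1
      rw [Nat.factorial_succ, pow_succ]
      push_cast
      field_simp
    rw [tsum_mul_right, tsum_mul_left, h4, hx, Real.mul_rpow (by positivity) (by positivity)]
    ring

/-- The sum of the `n`-particle components. -/
noncomputable def expansion (u b : ℕ → 𝓗) :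
    (FermiFockSpace 𝓗 →L[ℂ] FermiFockSpace 𝓗) →L[ℂ] FermiFockSpace 𝓗 :=
  ∑' n, component u b n

theorem hasSum_component (hub : Summable fun k => ‖u k‖ * ‖b k‖) :
    HasSum (component u b) (expansion u b) :=
  (ContinuousLinearMap.summable_of_norm_le ((Real.summable_pow_div_factorial _).mul_right _)
    (norm_component_le hub)).hasSum

theorem hasSum_component_apply (hub : Summable fun k => ‖u k‖ * ‖b k‖)
    (A : FermiFockSpace 𝓗 →L[ℂ] FermiFockSpace 𝓗) :
    HasSum (fun n => component u b n A) (expansion u b A) :=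
  (hasSum_component hub).mapL (ContinuousLinearMap.apply ℂ (FermiFockSpace 𝓗) A)

theorem pNuclearBound_expansion {p : ℝ} (hp : 0 < p) (hp1 : p ≤ 1)
    (hub : Summable fun k => (‖u k‖ * ‖b k‖) ^ p) :
    ∃ C, PNuclearBound p C (expansion u b).toLinearMap := by
  obtain ⟨C, hC⟩ := pNuclearBound_vacuumComponent (𝓗 := 𝓗) hp
  have hs : 0 ≤ ∑' k, (‖u k‖ * ‖b k‖) ^ p := tsum_nonneg fun k => by positivity
  set x : ℝ := (2 ^ p * ∑' k, (‖u k‖ * ‖b k‖) ^ p) ^ (1 / p) with hx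
  have hx0 : 0 ≤ x := by positivity
  have hxp : x ^ p = 2 ^ p * ∑' k, (‖u k‖ * ‖b k‖) ^ p := by
    rw [hx, ← Real.rpow_mul (by positivity), one_div_mul_cancel hp.ne', Real.rpow_one]
  exact ⟨_, pNuclearBound_of_hasSum hp hp1 (pNuclearBound_component hp hp1 hub hC hx0 hxp)
    ((summable_pow_div_factorial_rpow hx0 hp).mul_right C)
    (hasSum_component_apply (summable_of_summable_rpow hp hp1 (fun k => by positivity) hub))⟩

/-! ### Annihilation operators acting on the expansion. -/

theorem gradedDerivation_field_anticomm (f g : 𝓗) (A : FermiFockSpace 𝓗 →L[ℂ] FermiFockSpace 𝓗) :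
    gradedDerivation (field f) (gradedDerivation (field g) A)
      = -gradedDerivation (field g) (gradedDerivation (field f) A) :=
  gradedDerivation_anticomm (grading_field f) (grading_field g) (field_mul_field f g) A

theorem gradedDerivation_field_comm_hasSum {c : ℕ → ℂ} {B : FermiFockSpace 𝓗 →L[ℂ] FermiFockSpace 𝓗}
    (hB : HasSum (fun k => c k • field (u k)) B) (f : 𝓗)
    (A : FermiFockSpace 𝓗 →L[ℂ] FermiFockSpace 𝓗) :
    gradedDerivation B (gradedDerivation (field f) A)
      = -gradedDerivation (field f) (gradedDerivation B A) := by
  have h1 := hasSum_gradedDerivation hB (gradedDerivation (field f) A)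
  have h2 := ((hasSum_gradedDerivation hB A).mapL (gradedDerivation (field f))).neg
  have h3 : (fun k => c k • gradedDerivation (field (u k)) (gradedDerivation (field f) A))
      = fun k => -gradedDerivation (field f) (c k • gradedDerivation (field (u k)) A) :=
    funext fun k => by
      rw [gradedDerivation_field_anticomm, map_smul, smul_neg]
  rw [h3] at h1
  exact h1.unique h2

theorem annihilation_creation_apply (f g : 𝓗) (x : FermiFockSpace 𝓗) :
    annihilation f (creation g x) = ⟪f, g⟫ • x - creation g (annihilation f x) :=
  eq_sub_of_add_eq (DFunLike.congr_fun (annihilation_mul_creation f g) x)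

theorem annihilation_component_zero (z : 𝓗) (A : FermiFockSpace 𝓗 →L[ℂ] FermiFockSpace 𝓗) :
    annihilation z (component u b 0 A) = 0 := by
  rw [component, vacuumComponent_apply, map_smul, annihilation_vacuum, smul_zero]

/-- Commuting `a(z)` past `a(bₖ)*` leaves `⟪z, bₖ⟫`, and these terms sum to one copy of the claim.
In the remaining terms the induction hypothesis applies; the minus sign of the anticommutation
relation is undone by the anticommutation of `∂_B` with `∂_{uₖ}`, and the recursion reassembles them
into `n + 1` further copies. The total `n + 2` is the normalization on the left. -/
theorem annihilation_component_succ (hub : Summable fun k => ‖u k‖ * ‖b k‖) {z : 𝓗}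
    {B : FermiFockSpace 𝓗 →L[ℂ] FermiFockSpace 𝓗}
    (hB : HasSum (fun k => ⟪z, b k⟫ • field (u k)) B) (n : ℕ)
    (A : FermiFockSpace 𝓗 →L[ℂ] FermiFockSpace 𝓗) :
    annihilation z (component u b (n + 1) A) = component u b n (gradedDerivation B A) := by
  induction n generalizing A with
  | zero =>
    have h1 := (hasSum_raise_apply hub 0 A).mapL (annihilation z)
    have h2 := (hasSum_gradedDerivation hB A).mapL (component u b 0)
    have h3 : (fun k => annihilation z (creation (b k)
        (component u b 0 (gradedDerivation (field (u k)) A))))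
        = fun k => component u b 0 (⟪z, b k⟫ • gradedDerivation (field (u k)) A) :=
      funext fun k => by
        rw [annihilation_creation_apply, annihilation_component_zero, map_zero, sub_zero, map_smul]
    rw [h3] at h1
    simpa using h1.unique h2
  | succ n ih =>
    have h1 := (hasSum_raise_apply hub (n + 1) A).mapL (annihilation z)
    have h2 := ((hasSum_gradedDerivation hB A).mapL (component u b (n + 1))).add
      (hasSum_raise_apply hub n (gradedDerivation B A))
    have h3 : (fun k => annihilation z (creation (b k)
        (component u b (n + 1) (gradedDerivation (field (u k)) A))))
        = fun k => component u b (n + 1) (⟪z, b k⟫ • gradedDerivation (field (u k)) A)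
          + creation (b k) (component u b n (gradedDerivation (field (u k))
            (gradedDerivation B A))) :=
      funext fun k => by
        rw [annihilation_creation_apply, ih, gradedDerivation_field_comm_hasSum hB, map_neg,
          map_neg, sub_neg_eq_add, map_smul]
    rw [h3] at h1
    have h4 := h1.unique h2
    rw [map_smul] at h4
    have h5 : ((n + 1 : ℕ) : ℂ) + 1 ≠ 0 := Nat.cast_add_one_ne_zero _
    refine smul_right_injective _ h5 ?_
    simp only
    rw [h4]
    push_cast
    module

theorem annihilation_expansion (hub : Summable fun k => ‖u k‖ * ‖b k‖) {z : 𝓗}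
    {B : FermiFockSpace 𝓗 →L[ℂ] FermiFockSpace 𝓗}
    (hB : HasSum (fun k => ⟪z, b k⟫ • field (u k)) B)
    (A : FermiFockSpace 𝓗 →L[ℂ] FermiFockSpace 𝓗) :
    annihilation z (expansion u b A) = expansion u b (gradedDerivation B A) := by
  have h1 := (hasSum_component_apply hub A).mapL (annihilation z)
  -- The vacuum component is annihilated, so the series may start at degree one and shifts by one
  -- degree.
  rw [← hasSum_nat_add_iff' 1] at h1
  simp only [annihilation_component_succ hub hB, Finset.range_one, Finset.sum_singleton,
    annihilation_component_zero, sub_zero] at h1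
  exact h1.unique (hasSum_component_apply hub _)

theorem inner_vacuum_expansion (hub : Summable fun k => ‖u k‖ * ‖b k‖)
    (A : FermiFockSpace 𝓗 →L[ℂ] FermiFockSpace 𝓗) :
    ⟪vacuum 𝓗, expansion u b A⟫ = ⟪vacuum 𝓗, A (vacuum 𝓗)⟫ := by
  have h1 := (hasSum_component_apply hub A).mapL (innerSL ℂ (vacuum 𝓗))
  have h2 : ∀ n, ⟪vacuum 𝓗, component u b (n + 1) A⟫ = 0 := fun n => by
    have h3 := (hasSum_raise_apply hub n A).mapL (innerSL ℂ (vacuum 𝓗))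
    simp only [innerSL_apply_apply, inner_smul_right] at h3
    have h4 : (fun k => ⟪vacuum 𝓗, creation (b k)
        (component u b n (gradedDerivation (field (u k)) A))⟫) = fun _ => 0 := funext fun k => by
      rw [← inner_annihilation_left, annihilation_vacuum, inner_zero_left]
    rw [h4] at h3
    exact (mul_eq_zero.mp (h3.unique hasSum_zero)).resolve_left (Nat.cast_add_one_ne_zero n)
  have h5 := hasSum_single (f := fun n => ⟪vacuum 𝓗, component u b n A⟫) 0 fun n hn => by
    obtain ⟨m, rfl⟩ := Nat.exists_eq_succ_of_ne_zero hn
    exact h2 m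
  refine (h1.unique h5).trans ?_
  rw [component, vacuumComponent_apply, inner_smul_right, inner_vacuum_vacuum, mul_one]

end FermiFock

/-! ### From complex `ℓ^p` maps to real ones. -/

namespace BanachIdeal

universe v

variable {E E' : Type*} {F G : Type v} [NormedAddCommGroup E] [NormedSpace ℂ E]
  [NormedAddCommGroup E'] [NormedSpace ℝ E'] [NormedAddCommGroup F] [NormedSpace ℂ F]
  [NormedAddCommGroup G] [NormedSpace ℂ G]

theorem rank_real_comp_le (L : F →L[ℂ] G) (S : E →L[ℂ] F) (R : E' →L[ℝ] E) {n : ℕ}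
    (hS : LinearMap.rank (S : E →ₗ[ℂ] F) ≤ n) :
    LinearMap.rank (((L.restrictScalars ℝ).comp ((S.restrictScalars ℝ).comp R) : E' →L[ℝ] G) :
      E' →ₗ[ℝ] G) ≤ (2 * n : ℕ) := by
  set V : Submodule ℂ G := LinearMap.range ((L : F →ₗ[ℂ] G) ∘ₗ (S : E →ₗ[ℂ] F)) with hV
  have hle : LinearMap.range (((L.restrictScalars ℝ).comp ((S.restrictScalars ℝ).comp R) :
      E' →L[ℝ] G) : E' →ₗ[ℝ] G) ≤ V.restrictScalars ℝ := by
    rintro _ ⟨x, rfl⟩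
    exact ⟨R x, rfl⟩
  refine (Submodule.rank_mono hle).trans ?_
  have h1 : Module.rank ℝ (V.restrictScalars ℝ) = 2 * Module.rank ℂ V := rank_real_of_complex V
  have h2 : Module.rank ℂ V ≤ n := by
    refine le_trans ?_ hS
    exact LinearMap.rank_comp_le_right (S : E →ₗ[ℂ] F) (L : F →ₗ[ℂ] G)
  rw [h1]
  push_cast
  gcongr

theorem approximationNumber_real_comp_le (L : F →L[ℂ] G) (T : E →L[ℂ] F) (R : E' →L[ℝ] E) (n : ℕ) :
    approximationNumber ((L.restrictScalars ℝ).comp ((T.restrictScalars ℝ).comp R)) (2 * n)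
      ≤ (‖L‖ * ‖R‖ + 1) * approximationNumber T n := by
  -- The added `1` permits division even when `L` or `R` vanishes.
  have hK : 0 < ‖L‖ * ‖R‖ + 1 := by positivity
  rw [← div_le_iff₀' hK]
  refine le_csInf ⟨_, 0, by simp, rfl⟩ ?_
  rintro _ ⟨S, hS, rfl⟩
  rw [div_le_iff₀' hK]
  refine (approximationNumber_le (rank_real_comp_le L S R hS)).trans ?_
  refine ContinuousLinearMap.opNorm_le_bound _ (by positivity) fun x => ?_
  have h1 : ((L.restrictScalars ℝ).comp ((T.restrictScalars ℝ).comp R)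
      - (L.restrictScalars ℝ).comp ((S.restrictScalars ℝ).comp R)) x = L ((T - S) (R x)) := by
    simp
  rw [h1]
  calc ‖L ((T - S) (R x))‖ ≤ ‖L‖ * (‖T - S‖ * (‖R‖ * ‖x‖)) :=
        L.le_opNorm_of_le ((T - S).le_opNorm_of_le (R.le_opNorm x))
    _ = (‖L‖ * ‖R‖) * ‖T - S‖ * ‖x‖ := by ring
    _ ≤ _ := by gcongr; linarith

/-- Each odd term is dominated by the even term before it. This recovers all indices after complex
rank `n` has become real rank at most `2 * n`. -/
theorem summable_of_antitone_of_two_mul {a : ℕ → ℝ} (ha : Antitone a) (h0 : ∀ n, 0 ≤ a n)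
    (h : Summable fun n => a (2 * n)) : Summable a :=
  Summable.even_add_odd h (h.of_nonneg_of_le (fun _ => h0 _) fun _ => ha (Nat.le_succ _))

theorem summable_approximationNumber_real_comp {p : ℝ} (hp : 0 < p) {T : E →L[ℂ] F}
    (hT : Summable fun n => approximationNumber T n ^ p) (L : F →L[ℂ] G) (R : E' →L[ℝ] E) :
    Summable fun n => approximationNumber
      ((L.restrictScalars ℝ).comp ((T.restrictScalars ℝ).comp R)) n ^ p := by
  have h0 := approximationNumber_nonneg ((L.restrictScalars ℝ).comp ((T.restrictScalars ℝ).comp R))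
  refine summable_of_antitone_of_two_mul (fun m n hmn => ?_) (fun n => Real.rpow_nonneg (h0 n) p) ?_
  · exact Real.rpow_le_rpow (h0 n) (approximationNumber_antitone _ hmn) hp.le
  · refine Summable.of_nonneg_of_le (fun n => Real.rpow_nonneg (h0 _) p) (fun n => ?_)
      (hT.mul_left ((‖L‖ * ‖R‖ + 1) ^ p))
    rw [← Real.mul_rpow (by positivity) (approximationNumber_nonneg _ _)]
    exact Real.rpow_le_rpow (h0 _) (approximationNumber_real_comp_le L T R n) hp.le

/-- The expansion lives on all bounded operators, where its bounds do not involve `H`; this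
transfers them to its restriction to the field algebra. -/
theorem IsPNuclear.comp_clm {𝕜 A B C : Type*} [RCLike 𝕜] [NormedAddCommGroup A] [NormedSpace 𝕜 A]
    [NormedAddCommGroup B] [NormedSpace 𝕜 B] [NormedAddCommGroup C] [NormedSpace 𝕜 C] {p D : ℝ}
    (hp : 0 < p) {S : B →L[𝕜] C} (h : PNuclearBound p D S.toLinearMap) (R : A →L[𝕜] B)
    {T : A →ₗ[𝕜] C} (hT : ∀ x, T x = S (R x)) : IsPNuclear p T := by
  have h1 := (h.comp hp (ContinuousLinearMap.id 𝕜 C) R).isPNuclear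
  convert h1 using 1
  ext x
  exact hT x

end BanachIdeal

namespace FermiFock

open scoped ComplexInnerProductSpace

variable {𝓗 : Type*} [NormedAddCommGroup 𝓗] [InnerProductSpace ℂ 𝓗]

/-! ### Second quantization -/

theorem exteriorMap_algebraMap {D : Submodule ℂ 𝓗} (T : D →ₗ[ℂ] 𝓗) (c : ℂ) :
    exteriorMap T (algebraMap ℂ (ExteriorAlgebra ℂ D) c) = c • vacuum 𝓗 := by
  rw [exteriorMap_apply, AlgHom.commutes, Algebra.algebraMap_eq_smul_one, map_smul, vacuum_eq]

theorem exteriorMap_ι_mul {D : Submodule ℂ 𝓗} (T : D →ₗ[ℂ] 𝓗) (d : D) (y : ExteriorAlgebra ℂ D) :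
    exteriorMap T (ExteriorAlgebra.ι ℂ d * y) = creation (T d) (exteriorMap T y) := by
  rw [exteriorMap_apply, exteriorMap_apply, creation_toFock, map_mul, ExteriorAlgebra.map_apply_ι]

theorem contract_map {D : Submodule ℂ 𝓗} (T : D →ₗ[ℂ] 𝓗) (z : 𝓗) (y : ExteriorAlgebra ℂ D) :
    contract z (ExteriorAlgebra.map T y) = ExteriorAlgebra.map T
      (CliffordAlgebra.contractLeft (Q := (0 : QuadraticForm ℂ D))
        ((innerSL ℂ z).toLinearMap ∘ₗ T) y) := by
  induction y using CliffordAlgebra.left_induction with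
  | algebraMap r =>
    rw [CliffordAlgebra.contractLeft_algebraMap, map_zero]
    erw [AlgHom.commutes, contract_algebraMap]
  | add x y hx hy => simp only [map_add, hx, hy]
  | ι_mul x m ih =>
    have h : ∀ w, ExteriorAlgebra.map T (ExteriorAlgebra.ι ℂ m * w)
        = ExteriorAlgebra.ι ℂ (T m) * ExteriorAlgebra.map T w := fun w => by
      rw [map_mul, ExteriorAlgebra.map_apply_ι]
    rw [CliffordAlgebra.contractLeft_ι_mul, map_sub, map_smul]
    erw [h, h]
    rw [contract_ι_mul, ih]
    rfl

theorem annihilation_exteriorMap {D : Submodule ℂ 𝓗} (T : D →ₗ[ℂ] 𝓗) (z : 𝓗)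
    (y : ExteriorAlgebra ℂ D) :
    annihilation z (exteriorMap T y) = exteriorMap T
      (CliffordAlgebra.contractLeft (Q := (0 : QuadraticForm ℂ D))
        ((innerSL ℂ z).toLinearMap ∘ₗ T) y) := by
  rw [exteriorMap_apply, annihilation_toFock, contract_map, exteriorMap_apply]

/-- Only degree zero contributes, and there every induced map is the same. -/
theorem inner_vacuum_exteriorMap {D : Submodule ℂ 𝓗} (S T : D →ₗ[ℂ] 𝓗) (y : ExteriorAlgebra ℂ D) :
    ⟪vacuum 𝓗, exteriorMap S y⟫ = ⟪vacuum 𝓗, exteriorMap T y⟫ := by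
  induction y using CliffordAlgebra.left_induction with
  | algebraMap r => erw [exteriorMap_algebraMap, exteriorMap_algebraMap]
  | add x y hx hy => simp only [map_add, inner_add_right, hx, hy]
  | ι_mul x m _ =>
    have h : ∀ R : D →ₗ[ℂ] 𝓗, ⟪vacuum 𝓗, exteriorMap R (ExteriorAlgebra.ι ℂ m * x)⟫ = 0 := fun R => by
      rw [exteriorMap_ι_mul, ← inner_annihilation_left, annihilation_vacuum, inner_zero_left]
    exact (h S).trans (h T).symm

/-- Factors are moved across one at a time as contractions; the hypothesis says exactly that
contracting with `S m` after `T` and with `T m` after `S` is the same functional. It is used with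
the inclusion of the domain and `X₁`, giving symmetry of the second quantization. -/
theorem inner_exteriorMap_symm {D : Submodule ℂ 𝓗} {S T : D →ₗ[ℂ] 𝓗}
    (h : ∀ d d', ⟪S d, T d'⟫ = ⟪T d, S d'⟫) (y y' : ExteriorAlgebra ℂ D) :
    ⟪exteriorMap S y, exteriorMap T y'⟫ = ⟪exteriorMap T y, exteriorMap S y'⟫ := by
  induction y using CliffordAlgebra.left_induction generalizing y' with
  | algebraMap r =>
    erw [exteriorMap_algebraMap, exteriorMap_algebraMap]
    rw [inner_smul_left, inner_smul_left, inner_vacuum_exteriorMap S T]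
  | add x y hx hy => simp only [map_add, inner_add_left, hx, hy]
  | ι_mul x m ih =>
    have h1 : ((innerSL ℂ (S m)).toLinearMap ∘ₗ T) = ((innerSL ℂ (T m)).toLinearMap ∘ₗ S) :=
      LinearMap.ext fun d => h m d
    have h2 := exteriorMap_ι_mul S m x
    have h3 := exteriorMap_ι_mul T m x
    erw [h2, h3]
    rw [inner_creation_left, inner_creation_left, annihilation_exteriorMap,
      annihilation_exteriorMap, h1, ih]

theorem continuous_creation_apply (x : FermiFockSpace 𝓗) :
    Continuous fun f : 𝓗 => creation f x := by
  refine LipschitzWith.continuous (K := ‖x‖₊) (LipschitzWith.of_dist_le_mul fun f g => ?_)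
  have h : creation f x - creation g x = creation (f - g) x := by
    rw [sub_eq_add_neg f, creation_add, ← neg_one_smul ℂ g, creation_smul, neg_one_smul]
    exact sub_eq_add_neg _ _
  rw [dist_eq_norm, dist_eq_norm, h, coe_nnnorm, mul_comm]
  exact (creation (f - g)).le_of_opNorm_le (norm_creation_le _) x

/-- The closure of the algebraic domain of the second quantization. -/
noncomputable def closedRange (D : Submodule ℂ 𝓗) : Submodule ℂ (FermiFockSpace 𝓗) :=
  (LinearMap.range (exteriorMap D.subtype)).topologicalClosure

theorem isClosed_closedRange (D : Submodule ℂ 𝓗) :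
    IsClosed (closedRange D : Set (FermiFockSpace 𝓗)) :=
  Submodule.isClosed_topologicalClosure _

theorem exteriorMap_mem_closedRange {D : Submodule ℂ 𝓗} (y : ExteriorAlgebra ℂ D) :
    exteriorMap D.subtype y ∈ closedRange D :=
  Submodule.le_topologicalClosure _ ⟨y, rfl⟩

theorem creation_mem_closedRange_of_mem {D : Submodule ℂ 𝓗} (d : D) {x : FermiFockSpace 𝓗}
    (hx : x ∈ closedRange D) : creation (d : 𝓗) x ∈ closedRange D := by
  refine Submodule.topologicalClosure_minimal
    (t := (closedRange D).comap (creation (d : 𝓗)).toLinearMap)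
    (LinearMap.range (exteriorMap D.subtype)) ?_
    ((isClosed_closedRange D).preimage (creation (d : 𝓗)).continuous) hx
  rintro _ ⟨y, rfl⟩
  have h := exteriorMap_ι_mul D.subtype d y
  exact (congrArg (· ∈ closedRange D) h).mp (exteriorMap_mem_closedRange _)

theorem creation_mem_closedRange {D : Submodule ℂ 𝓗} (hD : Dense (D : Set 𝓗)) (f : 𝓗)
    {x : FermiFockSpace 𝓗} (hx : x ∈ closedRange D) : creation f x ∈ closedRange D :=
  closure_minimal (s := (D : Set 𝓗)) (t := {f | creation f x ∈ closedRange D})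
    (fun d hd => creation_mem_closedRange_of_mem ⟨d, hd⟩ hx)
    ((isClosed_closedRange D).preimage (continuous_creation_apply x)) (hD f)

theorem toFock_mem_closedRange {D : Submodule ℂ 𝓗} (hD : Dense (D : Set 𝓗))
    (x : ExteriorAlgebra ℂ 𝓗) : toFock x ∈ closedRange D := by
  induction x using CliffordAlgebra.left_induction with
  | algebraMap r =>
    have h1 : exteriorMap D.subtype (algebraMap ℂ (ExteriorAlgebra ℂ D) r)
        = toFock (algebraMap ℂ (ExteriorAlgebra ℂ 𝓗) r) := by
      rw [exteriorMap_apply, AlgHom.commutes]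
    exact (congrArg (· ∈ closedRange D) h1).mp (exteriorMap_mem_closedRange _)
  | add x y hx hy => rw [map_add]; exact (closedRange D).add_mem hx hy
  | ι_mul x m ih =>
    exact (congrArg (· ∈ closedRange D) (creation_toFock m x)).mp (creation_mem_closedRange hD m ih)

/-- The closed range is stable under `a(d)*` for `d ∈ D`, hence under every `a(f)*` because `a(f)*
x` depends continuously on `f`. It contains the vacuum line, so it contains the whole exterior
algebra. -/
theorem denseRange_exteriorMap_subtype {D : Submodule ℂ 𝓗} (hD : Dense (D : Set 𝓗)) :
    DenseRange (exteriorMap D.subtype) := fun x =>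
  closure_minimal (Set.range_subset_iff.mpr (toFock_mem_closedRange hD)) (isClosed_closedRange D)
    (denseRange_toFock x)

theorem exteriorMap_mem_domain (X₁ : 𝓗 →ₗ.[ℂ] 𝓗) (y : ExteriorAlgebra ℂ X₁.domain) :
    exteriorMap X₁.domain.subtype y ∈ (secondQuantizationCore X₁).domain :=
  ⟨y, rfl⟩

theorem secondQuantizationCore_apply (X₁ : 𝓗 →ₗ.[ℂ] 𝓗) (y : ExteriorAlgebra ℂ X₁.domain) :
    secondQuantizationCore X₁ ⟨_, exteriorMap_mem_domain X₁ y⟩ = exteriorMap X₁.toFun y := by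
  have h : (LinearEquiv.ofInjective _ (exteriorMap_subtype_injective X₁.domain)).symm
      ⟨_, exteriorMap_mem_domain X₁ y⟩ = y :=
    (LinearEquiv.ofInjective _ (exteriorMap_subtype_injective X₁.domain)).symm_apply_apply y
  change exteriorMap X₁.toFun ((LinearEquiv.ofInjective _
    (exteriorMap_subtype_injective X₁.domain)).symm ⟨_, exteriorMap_mem_domain X₁ y⟩) = _
  rw [h]

theorem secondQuantization_apply (X₁ : 𝓗 →ₗ.[ℂ] 𝓗) (y : ExteriorAlgebra ℂ X₁.domain)
    (x : (secondQuantization X₁).domain) (hx : (x : FermiFockSpace 𝓗)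
      = exteriorMap X₁.domain.subtype y) :
    secondQuantization X₁ x = exteriorMap X₁.toFun y := by
  rw [← secondQuantizationCore_apply]
  exact ((secondQuantizationCore X₁).le_closure.2 hx.symm).symm

/-- The identity holds on the graph of the algebraic operator and is a closed condition on pairs, so
it persists on the closure of the graph. -/
theorem inner_secondQuantization {X₁ : 𝓗 →ₗ.[ℂ] 𝓗}
    (hX₁ : ∀ d d' : X₁.domain, ⟪X₁ d, (d' : 𝓗)⟫ = ⟪(d : 𝓗), X₁ d'⟫)
    (y : ExteriorAlgebra ℂ X₁.domain) (x : (secondQuantization X₁).domain) :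
    ⟪exteriorMap X₁.domain.subtype y, secondQuantization X₁ x⟫
      = ⟪exteriorMap X₁.toFun y, (x : FermiFockSpace 𝓗)⟫ := by
  set P : Set (FermiFockSpace 𝓗 × FermiFockSpace 𝓗) :=
    {q | ⟪exteriorMap X₁.domain.subtype y, q.2⟫ = ⟪exteriorMap X₁.toFun y, q.1⟫} with hP
  have hPc : IsClosed P := isClosed_eq (by fun_prop) (by fun_prop)
  have hPg : ((secondQuantizationCore X₁).graph : Set _) ⊆ P := by
    rintro ⟨q₁, q₂⟩ hq
    obtain ⟨⟨_, y', rfl⟩, rfl, rfl⟩ := (LinearPMap.mem_graph_iff _).mp hq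
    have h := secondQuantizationCore_apply X₁ y'
    change ⟪_, _⟫ = ⟪_, _⟫
    refine (congrArg (fun v => ⟪exteriorMap X₁.domain.subtype y, v⟫) h).trans ?_
    exact (inner_exteriorMap_symm (fun d d' => hX₁ d d') y y').symm
  have hmem : ((x : FermiFockSpace 𝓗), secondQuantization X₁ x)
      ∈ closure ((secondQuantizationCore X₁).graph : Set _) := by
    have h1 : ((x : FermiFockSpace 𝓗), secondQuantization X₁ x)
        ∈ (secondQuantizationCore X₁).closure.graph := (secondQuantization X₁).mem_graph x
    -- For a non-closable operator `LinearPMap.closure` is by convention the operator itself, so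
    -- closability need not be established.
    by_cases hc : (secondQuantizationCore X₁).IsClosable
    · have h2 := hc.graph_closure_eq_closure_graph
      rw [← h2] at h1
      exact h1
    · refine subset_closure ?_
      rw [LinearPMap.closure_def' hc] at h1
      exact h1
  exact closure_minimal hPg hPc hmem

/-! ### The field algebra -/

theorem mem_fieldAlgebra_iff {H : ClosedSubmodule ℝ 𝓗}
    {A : FermiFockSpace 𝓗 →L[ℂ] FermiFockSpace 𝓗} :
    A ∈ fieldAlgebra H ↔ ∀ C : FermiFockSpace 𝓗 →L[ℂ] FermiFockSpace 𝓗,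
      (∀ h ∈ H, field h * C = C * field h) → C * A = A * C := by
  rw [← SetLike.mem_coe, coe_fieldAlgebra, Set.mem_centralizer_iff]
  refine forall_congr' fun C => ?_
  rw [Set.mem_centralizer_iff, Set.forall_mem_image]
  rfl

theorem field_mem_fieldAlgebra {H : ClosedSubmodule ℝ 𝓗} {h : 𝓗} (hh : h ∈ H) :
    field h ∈ fieldAlgebra H :=
  mem_fieldAlgebra_iff.mpr fun _ hC => (hC h hh).symm

/-- The grading only changes the sign of the fields, so it maps their commutant to itself, and hence
also the double commutant. -/
theorem grading_mem_fieldAlgebra {H : ClosedSubmodule ℝ 𝓗}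
    {A : FermiFockSpace 𝓗 →L[ℂ] FermiFockSpace 𝓗} (hA : A ∈ fieldAlgebra H) :
    grading A ∈ fieldAlgebra H := by
  rw [mem_fieldAlgebra_iff] at hA ⊢
  intro C hC
  have h1 := hA (grading C) fun h hh => by
    have := congrArg grading (hC h hh)
    rw [grading_mul, grading_mul, grading_field, neg_mul, mul_neg, neg_inj] at this
    exact this
  have := congrArg grading h1
  rwa [grading_mul, grading_mul, grading_grading] at this

theorem mem_fieldAlgebra_of_hasSum {H : ClosedSubmodule ℝ 𝓗} {c : ℕ → ℂ} {u : ℕ → 𝓗}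
    (hu : ∀ k, u k ∈ H) {B : FermiFockSpace 𝓗 →L[ℂ] FermiFockSpace 𝓗}
    (hB : HasSum (fun k => c k • field (u k)) B) : B ∈ fieldAlgebra H := by
  refine mem_fieldAlgebra_iff.mpr fun C hC => ?_
  have h1 := hB.mul_left C
  have h2 := hB.mul_right C
  have h3 : (fun k => C * c k • field (u k)) = fun k => c k • field (u k) * C := funext fun k => by
    rw [mul_smul_comm, smul_mul_assoc, hC _ (hu k)]
  rw [h3] at h1
  exact h1.unique h2

theorem gradedDerivation_mem_fieldAlgebra {H : ClosedSubmodule ℝ 𝓗}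
    {A B : FermiFockSpace 𝓗 →L[ℂ] FermiFockSpace 𝓗} (hA : A ∈ fieldAlgebra H)
    (hB : B ∈ fieldAlgebra H) : gradedDerivation B A ∈ fieldAlgebra H := by
  rw [gradedDerivation_apply]
  have h1 := (fieldAlgebra H).toStarSubalgebra.mul_mem hB hA
  have h2 := (fieldAlgebra H).toStarSubalgebra.mul_mem (grading_mem_fieldAlgebra hA) hB
  exact (fieldAlgebra H).toStarSubalgebra.smul_mem
    ((fieldAlgebra H).toStarSubalgebra.toSubalgebra.sub_mem h1 h2) _

/-- On the field algebra, annihilation operators act on the vacuum orbit as graded derivations. -/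
theorem annihilation_apply_vacuum {H : ClosedSubmodule ℝ 𝓗} {w : 𝓗} {c : ℕ → ℂ} {u : ℕ → 𝓗}
    {B : FermiFockSpace 𝓗 →L[ℂ] FermiFockSpace 𝓗} (hB : HasSum (fun k => c k • field (u k)) B)
    (hw : ∀ h ∈ H, HasSum (fun k => c k * (⟪u k, h⟫.re : ℂ)) ⟪w, h⟫)
    {A : FermiFockSpace 𝓗 →L[ℂ] FermiFockSpace 𝓗} (hA : A ∈ fieldAlgebra H) :
    annihilation w (A (vacuum 𝓗)) = gradedDerivation B A (vacuum 𝓗) := by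
  set C : FermiFockSpace 𝓗 →L[ℂ] FermiFockSpace 𝓗 := annihilation w - (1 / 2 : ℂ) • B with hC
  -- The anticommutator of `B` with `Φ[h]` is twice that of `a(w)`, which fixes the factor `1 / 2`
  -- in `C`.
  have hBf : ∀ h ∈ H, B * field h + field h * B = (2 * ⟪w, h⟫) • 1 := fun h hh => by
    have h1 := (hB.mul_right (field h)).add (hB.mul_left (field h))
    have h2 : (fun k => c k • field (u k) * field h + field h * c k • field (u k))
        = fun k => (2 * (c k * (⟪u k, h⟫.re : ℂ))) •
          (1 : FermiFockSpace 𝓗 →L[ℂ] FermiFockSpace 𝓗) := funext fun k => by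
      rw [smul_mul_assoc, mul_smul_comm, ← smul_add, field_mul_field, smul_smul]
      congr 1
      ring
    rw [h2] at h1
    exact h1.unique (((hw h hh).mul_left 2).smul_const _)
  have hCf : ∀ h ∈ H, C * field h + field h * C = 0 := fun h hh => by
    have h1 : C * field h + field h * C = (annihilation w * field h + field h * annihilation w)
        - (1 / 2 : ℂ) • (B * field h + field h * B) := by
      rw [hC, sub_mul, mul_sub, smul_mul_assoc, mul_smul_comm, smul_add]
      abel
    rw [h1, hBf h hh, annihilation_mul_field, smul_smul]
    simp
  -- Both `C` and parity anticommute with every `Φ[h]`, so their product commutes with them and lies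
  -- in the commutant. Evaluating the resulting `C A = γ(A) C` on the vacuum, where `a(w)` vanishes,
  -- gives the claim.
  have h1 : parity 𝓗 * C * A = A * (parity 𝓗 * C) := by
    refine mem_fieldAlgebra_iff.mp hA _ fun h hh => ?_
    have h2 := eq_neg_of_add_eq_zero_left (hCf h hh)
    have h3 : field h * parity 𝓗 = -(parity 𝓗 * field h) := by
      rw [parity_mul_field, neg_neg]
    rw [← mul_assoc, h3, mul_assoc _ C, h2, mul_neg, neg_mul, mul_assoc]
  have h4 : C * A = grading A * C := by
    have := congrArg (parity 𝓗 * ·) h1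
    simp only [← mul_assoc, parity_mul_parity, one_mul] at this
    exact this
  have h5 := DFunLike.congr_fun h4 (vacuum 𝓗)
  have h6 : ∀ x, C x = annihilation w x - (1 / 2 : ℂ) • B x := fun x => rfl
  rw [mul_apply_eq_comp, mul_apply_eq_comp, h6, h6, annihilation_vacuum, zero_sub, map_neg,
    map_smul] at h5
  have h7 : gradedDerivation B A (vacuum 𝓗)
      = (1 / 2 : ℂ) • (B (A (vacuum 𝓗)) - grading A (B (vacuum 𝓗))) := rfl
  rw [h7, smul_sub, sub_eq_add_neg, ← h5]
  abel

theorem summable_inner_smul_field {u b : ℕ → 𝓗} (hub : Summable fun k => ‖u k‖ * ‖b k‖) (z : 𝓗) :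
    Summable fun k => ⟪z, b k⟫ • field (u k) := by
  refine ContinuousLinearMap.summable_of_norm_le (hub.mul_left (2 * ‖z‖)) fun k => ?_
  rw [ContinuousLinearMap.norm_smul_eq]
  calc _ ≤ (‖z‖ * ‖b k‖) * (2 * ‖u k‖) := by
        gcongr
        · exact norm_inner_le_norm _ _
        · exact norm_field_le _
    _ = _ := by ring

/-- Induction on wedge products: moving the outermost factor to the right replaces `A` by the same
`∂_B A` on both sides. The operator `A` must vary in the induction, and `∂_B A` is again in the
field algebra because every `uₖ` lies in `H`. -/
theorem inner_exteriorMap_expansion {H : ClosedSubmodule ℝ 𝓗} {D : Submodule ℂ 𝓗}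
    {T : D →ₗ[ℂ] 𝓗} {u b : ℕ → 𝓗} (hub : Summable fun k => ‖u k‖ * ‖b k‖) (hu : ∀ k, u k ∈ H)
    (hT : ∀ d : D, ∀ h ∈ H, HasSum (fun k => ⟪(d : 𝓗), b k⟫ * (⟪u k, h⟫.re : ℂ)) ⟪T d, h⟫)
    (y : ExteriorAlgebra ℂ D) {A : FermiFockSpace 𝓗 →L[ℂ] FermiFockSpace 𝓗}
    (hA : A ∈ fieldAlgebra H) :
    ⟪exteriorMap D.subtype y, expansion u b A⟫ = ⟪exteriorMap T y, A (vacuum 𝓗)⟫ := by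
  induction y using CliffordAlgebra.left_induction generalizing A with
  | algebraMap r =>
    erw [exteriorMap_algebraMap, exteriorMap_algebraMap]
    rw [inner_smul_left, inner_smul_left, inner_vacuum_expansion hub]
  | add x y hx hy => simp only [map_add, inner_add_left, hx hA, hy hA]
  | ι_mul x m ih =>
    have h2 := exteriorMap_ι_mul D.subtype m x
    have h3 := exteriorMap_ι_mul T m x
    erw [h2, h3]
    have hB := (summable_inner_smul_field hub (m : 𝓗)).hasSum
    rw [inner_creation_left, inner_creation_left, Submodule.subtype_apply,
      annihilation_expansion hub hB, annihilation_apply_vacuum hB (hT m) hA]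
    exact ih (gradedDerivation_mem_fieldAlgebra hA (mem_fieldAlgebra_of_hasSum hu hB))

theorem xi_apply {H : ClosedSubmodule ℝ 𝓗} {X₁ : 𝓗 →ₗ.[ℂ] 𝓗}
    (hX : ∀ A ∈ fieldAlgebra H, A (vacuum 𝓗) ∈ (secondQuantization X₁).domain)
    (A : (fieldAlgebra H).toStarSubalgebra) :
    xi H X₁ hX A = secondQuantization X₁ ⟨A.1 (vacuum 𝓗), hX A.1 A.2⟩ := rfl

theorem xi_eq_expansion {H : ClosedSubmodule ℝ 𝓗} {X₁ : 𝓗 →ₗ.[ℂ] 𝓗}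
    (hdense : Dense (X₁.domain : Set 𝓗))
    (hsymm : ∀ d d' : X₁.domain, ⟪X₁ d, (d' : 𝓗)⟫ = ⟪(d : 𝓗), X₁ d'⟫)
    (hX : ∀ A ∈ fieldAlgebra H, A (vacuum 𝓗) ∈ (secondQuantization X₁).domain)
    {u b : ℕ → 𝓗} (hub : Summable fun k => ‖u k‖ * ‖b k‖) (hu : ∀ k, u k ∈ H)
    (hT : ∀ d : X₁.domain, ∀ h ∈ H,
      HasSum (fun k => ⟪(d : 𝓗), b k⟫ * (⟪u k, h⟫.re : ℂ)) ⟪X₁ d, h⟫)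
    (A : (fieldAlgebra H).toStarSubalgebra) :
    xi H X₁ hX A = expansion u b A.1 := by
  refine ext_inner_left ℂ fun v => ?_
  induction v using (denseRange_exteriorMap_subtype hdense).induction_on with
  | hp => exact isClosed_eq (by fun_prop) (by fun_prop)
  | ih y =>
    rw [xi_apply, inner_secondQuantization hsymm]
    exact (inner_exteriorMap_expansion hub hu hT y A.2).symm

/-! ### The one-particle space -/

/-- The embedding of the one-particle space into the Fock space. -/
noncomputable def oneParticle (𝓗 : Type*) [NormedAddCommGroup 𝓗] [InnerProductSpace ℂ 𝓗] :
    𝓗 →ₗᵢ[ℂ] FermiFockSpace 𝓗 :=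
  LinearMap.isometryOfInner ((toFock (𝓗 := 𝓗)).toLinearMap ∘ₗ ExteriorAlgebra.ι ℂ) fun f g => by
    change ⟪toFock (ExteriorAlgebra.ι ℂ f), toFock (ExteriorAlgebra.ι ℂ g)⟫ = _
    rw [← creation_vacuum, ← creation_vacuum, inner_creation_left, annihilation_creation_apply,
      annihilation_vacuum, map_zero, sub_zero, inner_smul_right, inner_vacuum_vacuum, mul_one]

theorem xi_field {H : ClosedSubmodule ℝ 𝓗} {X₁ : 𝓗 →ₗ.[ℂ] 𝓗}
    (hX : ∀ A ∈ fieldAlgebra H, A (vacuum 𝓗) ∈ (secondQuantization X₁).domain)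
    {h : 𝓗} (hh : h ∈ H) (hd : h ∈ X₁.domain) :
    xi H X₁ hX ⟨field h, field_mem_fieldAlgebra hh⟩ = oneParticle 𝓗 (X₁ ⟨h, hd⟩) := by
  rw [xi_apply, secondQuantization_apply X₁ (ExteriorAlgebra.ι ℂ ⟨h, hd⟩)]
  · rw [exteriorMap_apply, ExteriorAlgebra.map_apply_ι]
    rfl
  · rw [exteriorMap_apply, ExteriorAlgebra.map_apply_ι]
    exact field_vacuum h

variable [CompleteSpace 𝓗]

/-- The map `x ↦ Φ[E_H x]` into the field algebra. -/
noncomputable def projectedField (H : ClosedSubmodule ℝ 𝓗) :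
    𝓗 →L[ℝ] (fieldAlgebra H).toStarSubalgebra :=
  LinearMap.mkContinuous
    { toFun := fun x =>
        ⟨field (realProjection H x), field_mem_fieldAlgebra (realProjection_mem H x)⟩
      map_add' := fun x y => Subtype.ext (by
        change field (realProjection H (x + y)) = _ + _
        rw [map_add, field_add])
      map_smul' := fun c x => Subtype.ext (by
        change field (realProjection H (c • x)) = _
        rw [map_smul, field_real_smul]
        rfl) }
    (2 * ‖realProjection H‖) fun x => by
      change ‖field (realProjection H x)‖ ≤ _
      refine (norm_field_le _).trans ?_
      rw [mul_assoc]
      gcongr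
      exact (realProjection H).le_opNorm x

/-- The map factors as `x ↦ Φ[E_H x]`, followed by `Ξ`, followed by the adjoint of the one-particle
embedding, which is a left inverse of that isometry. -/
theorem isEllP_oneParticleOperator {H : ClosedSubmodule ℝ 𝓗} {X₁ : 𝓗 →ₗ.[ℂ] 𝓗}
    (hH : ∀ h ∈ H, h ∈ X₁.domain)
    (hX : ∀ A ∈ fieldAlgebra H, A (vacuum 𝓗) ∈ (secondQuantization X₁).domain) {p : ℝ} (hp : 0 < p)
    (h : IsEllP p (xi H X₁ hX)) : IsEllP p (oneParticleOperator H X₁ hH) := by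
  obtain ⟨T, hT, hs⟩ := h
  refine ⟨_, ?_, summable_approximationNumber_real_comp hp hs
    (ContinuousLinearMap.adjoint (oneParticle 𝓗).toContinuousLinearMap) (projectedField H)⟩
  ext x
  have h1 : T (projectedField H x) = oneParticle 𝓗 (oneParticleOperator H X₁ hH x) := by
    have h2 := DFunLike.congr_fun hT (projectedField H x)
    exact h2.trans (xi_field hX (realProjection_mem H x) (hH _ (realProjection_mem H x)))
  change ContinuousLinearMap.adjoint (oneParticle 𝓗).toContinuousLinearMap
    (T (projectedField H x)) = _
  rw [h1]
  refine ext_inner_left ℂ fun v => ?_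
  rw [ContinuousLinearMap.adjoint_inner_right]
  exact (oneParticle 𝓗).inner_map_map _ _

open scoped ClosedSubmodule in
theorem realProjection_of_mem {H : ClosedSubmodule ℝ 𝓗} {h : 𝓗} (hh : h ∈ H) :
    realProjection H h = h :=
  Submodule.starProjection_eq_self_iff.mpr hh

open scoped ClosedSubmodule in
-- The Riesz vectors of the functionals need not lie in `H`. Projecting them by `E_H` changes
-- nothing on `H` and does not increase norms, while it puts the fields `Φ[uₖ]` into the field
-- algebra.
theorem exists_decomposition_oneParticleOperator {H : ClosedSubmodule ℝ 𝓗} {X₁ : 𝓗 →ₗ.[ℂ] 𝓗}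
    (hH : ∀ h ∈ H, h ∈ X₁.domain) {p : ℝ} (hp : 0 < p)
    (h : IsPNuclear p (oneParticleOperator H X₁ hH)) :
    ∃ u b : ℕ → 𝓗, (∀ k, u k ∈ H) ∧ (Summable fun k => (‖u k‖ * ‖b k‖) ^ p) ∧
      ∀ x (hx : x ∈ H), HasSum (fun k => (⟪u k, x⟫.re : ℂ) • b k) (X₁ ⟨x, hH x hx⟩) := by
  obtain ⟨φ, b, h1, h2⟩ := h
  let v : ℕ → 𝓗 := fun k => (InnerProductSpace.toDual ℝ 𝓗).symm (φ k)
  have hv : ∀ k, ‖v k‖ = ‖φ k‖ := fun k =>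
    LinearIsometryEquiv.norm_map (InnerProductSpace.toDual ℝ 𝓗).symm (φ k)
  refine ⟨fun k => realProjection H (v k), b, fun k => realProjection_mem H _, ?_, fun x hx => ?_⟩
  · refine h2.of_nonneg_of_le (fun k => by positivity) fun k => ?_
    rw [Real.mul_rpow (norm_nonneg _) (norm_nonneg _)]
    gcongr
    rw [← hv]
    exact Submodule.norm_starProjection_apply_le _ _
  · have h3 : oneParticleOperator H X₁ hH x = X₁ ⟨x, hH x hx⟩ := by
      change X₁ ⟨realProjection H x, _⟩ = _
      congr 1
      exact Subtype.ext (realProjection_of_mem hx)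
    rw [← h3]
    have h4 : (fun k => (⟪realProjection H (v k), x⟫.re : ℂ) • b k) = fun k => φ k x • b k :=
      funext fun k => by
        have h5 : inner ℝ (realProjection H (v k)) x = φ k x := by
          have h6 : inner ℝ (realProjection H (v k)) x = inner ℝ (v k) (realProjection H x) :=
            Submodule.inner_starProjection_left_eq_right _ _ _
          rw [h6, realProjection_of_mem hx]
          exact InnerProductSpace.toDual_symm_apply
        have h7 : ⟪realProjection H (v k), x⟫.re = φ k x := h5
        rw [h7, Complex.coe_smul]
    rw [h4]
    exact h1 x

open scoped ClosedSubmodule in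
theorem isPNuclear_oneParticleOperator {H : ClosedSubmodule ℝ 𝓗} {X₁ : 𝓗 →ₗ.[ℂ] 𝓗}
    (hH : ∀ h ∈ H, h ∈ X₁.domain) {p : ℝ} (hp : 0 < p) (hp1 : p ≤ 1)
    (h : IsEllP p (oneParticleOperator H X₁ hH)) : IsPNuclear p (oneParticleOperator H X₁ hH) :=
  IsEllP.isPNuclear (𝕜 := ℝ) (E := 𝓗) (F := 𝓗) hp hp1 h

theorem isPNuclear_xi {H : ClosedSubmodule ℝ 𝓗} {X₁ : 𝓗 →ₗ.[ℂ] 𝓗} (hX₁ : IsSelfAdjoint X₁)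
    (hH : ∀ h ∈ H, h ∈ X₁.domain)
    (hX : ∀ A ∈ fieldAlgebra H, A (vacuum 𝓗) ∈ (secondQuantization X₁).domain) {p : ℝ} (hp : 0 < p)
    (hp1 : p ≤ 1) (h : IsPNuclear p (oneParticleOperator H X₁ hH)) :
    IsPNuclear p (xi H X₁ hX) := by
  obtain ⟨u, b, hu, hub, hT⟩ := exists_decomposition_oneParticleOperator hH hp h
  have hsymm : ∀ d d' : X₁.domain, ⟪X₁ d, (d' : 𝓗)⟫ = ⟪(d : 𝓗), X₁ d'⟫ := by
    have h1 := LinearPMap.adjoint_isFormalAdjoint hX₁.dense_domain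
    rw [LinearPMap.isSelfAdjoint_def.mp hX₁] at h1
    intro d d'
    exact h1 d d'
  obtain ⟨C, hC⟩ := pNuclearBound_expansion hp hp1 hub
  have hub1 := summable_of_summable_rpow hp hp1 (fun k => by positivity) hub
  refine IsPNuclear.comp_clm hp hC
    ((fieldAlgebra H).toStarSubalgebra.toSubalgebra.toSubmodule.subtypeL)
    (xi_eq_expansion hX₁.dense_domain hsymm hX hub1 hu fun d h hh => ?_)
  -- Symmetry moves `X₁` onto `h ∈ H`, where the nuclear decomposition is available.
  rw [hsymm d ⟨h, hH h hh⟩]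
  have h2 := (hT h hh).mapL (innerSL ℂ (d : 𝓗))
  simp only [innerSL_apply_apply, inner_smul_right] at h2
  simpa only [mul_comm] using h2

end FermiFock

/-! ### The theorem. -/

theorem theorem3p12 {𝓗 : Type*} [NormedAddCommGroup 𝓗] [InnerProductSpace ℂ 𝓗] [CompleteSpace 𝓗]
    (H : ClosedSubmodule ℝ 𝓗) (X₁ : 𝓗 →ₗ.[ℂ] 𝓗) (hX₁ : IsSelfAdjoint X₁)
    (hH : ∀ h ∈ H, h ∈ X₁.domain)
    (hX : ∀ A ∈ FermiFock.fieldAlgebra H,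
      A (FermiFock.vacuum 𝓗) ∈ (FermiFock.secondQuantization X₁).domain) :
    (∀ p : ℝ, 0 < p → p ≤ 1 →
      BanachIdeal.IsEllP p (FermiFock.oneParticleOperator H X₁ hH) →
        BanachIdeal.IsPNuclear p (FermiFock.xi H X₁ hX) ∧
        (p < 1 → ∀ q : ℝ, p / (1 - p) < q → BanachIdeal.IsEllP q (FermiFock.xi H X₁ hX)) ∧
        (p = 1 → IsCompactOperator (FermiFock.xi H X₁ hX))) ∧
    (∀ p : ℝ, 0 < p →
      BanachIdeal.IsEllP p (FermiFock.xi H X₁ hX) →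
        BanachIdeal.IsEllP p (FermiFock.oneParticleOperator H X₁ hH)) ∧
    ((∀ p : ℝ, 0 < p → BanachIdeal.IsEllP p (FermiFock.xi H X₁ hX)) ↔
      ∀ p : ℝ, 0 < p → BanachIdeal.IsEllP p (FermiFock.oneParticleOperator H X₁ hH)) := by
  have ha : ∀ p : ℝ, 0 < p → p ≤ 1 → IsEllP p (FermiFock.oneParticleOperator H X₁ hH) →
      IsPNuclear p (FermiFock.xi H X₁ hX) := fun p hp hp1 h =>
    FermiFock.isPNuclear_xi hX₁ hH hX hp hp1 (FermiFock.isPNuclear_oneParticleOperator hH hp hp1 h)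
  have hb : ∀ p : ℝ, 0 < p → IsEllP p (FermiFock.xi H X₁ hX) →
      IsEllP p (FermiFock.oneParticleOperator H X₁ hH) :=
    fun p hp h => FermiFock.isEllP_oneParticleOperator hH hX hp h
  refine ⟨fun p hp hp1 h => ⟨ha p hp hp1 h, fun hp1' q hq => (ha p hp hp1 h).isEllP hp hp1' hq,
    ?_⟩, hb, fun h p hp => hb p hp (h p hp), fun h q hq => ?_⟩
  · rintro rfl
    exact (ha 1 hp hp1 h).isCompactOperator
  -- With `p = q / (2 + q)` one has `p / (1 - p) = q / 2 < q`, so (a) yields exactly the required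
  -- `ℓ^q`.
  · have hp : 0 < q / (2 + q) := by positivity
    have hp1 : q / (2 + q) < 1 := (div_lt_one (by positivity)).mpr (by linarith)
    refine (ha _ hp hp1.le (h _ hp)).isEllP hp hp1 ?_
    rw [one_sub_div (by positivity), div_div_div_cancel_right₀ (by positivity), add_sub_cancel_right]
    linarith
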